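/- Let $X\in\mathbb R^{m\times n}$ have rank $r$ and full singular value decomposition $X=U\Sigma V^T$, where $U=[u_1,\dots,u_m]$ and $V=[v_1,\dots,v_n]$ are orthogonal and $\sigma_1\ge\sigma_2\ge\cdots\ge\sigma_m\ge 0$ are the singular values (with $\sigma_i=0$ for $i>r$). Fix $k\ge 1$ and let $$J(W,S)=\tfrac12\|X-WS\|_F^2,\qquad (W,S)\in\mathcal X=\mathbb R^{m\times k}\times\mathbb R^{k\times n},$$ where $\mathcal X$ carries the inner product $\langle (G,H),(G',H')\rangle=\langle G,G'\rangle+\langle H,H'\rangle$. Let $\nabla^2 J(W,S):\mathcal X\to\mathcal X$ denote the Hessian map (the derivative of the gradient of $J$) and $\lambda_{\min}$ its least eigenvalue. A strict saddle is a point with $\nabla J(W,S)=0$ and $\lambda_{\min}(\nabla^2J(W,S))<0$. Let $1\le q\le\min\{k,m\}$. Choose $q$ distinct indices in $\{1,\dots,m\}$, ordered so that the corresponding singular values satisfy $\lambda_1\ge\cdots\ge\lambda_q$; let $\bar U$ and $\bar V$ have the corresponding left and right singular vectors as columns (if $n<m$, a left singular vector $u_i$ with $i>n$ has no right partner, and the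 corresponding column of $\bar V$ is taken to be $0$), let $\Lambda=\mathrm{diag}(\lambda_1,\dots,\lambda_q)$, $V_0=[v_{r+1},\dots,v_n]$ and $C_0\in\mathbb R^{(n-r)\times(k-q)}$. The point $$(W_c,S_c)=\left(\begin{bmatrix}\bar U & 0_{m\times(k-q)}\end{bmatrix},\ \begin{bmatrix}\Lambda\bar V^T\\ C_0^TV_0^T\end{bmatrix}\right)$$ is called a canonical point. It is maximal if $\lambda_j=\sigma_j$ for all $1\le j\le q$. If it is not maximal, let $p\in\{1,\dots,q\}$ be the least integer with $\lambda_p<\sigma_p$ (such an integer exists). If $q<k$, let $\omega_{k-q}$ be the smallest eigenvalue of $C_0^TC_0$. Then: (a) If $q=m$, or if $q=k<m$ and $(W_c,S_c)$ is maximal, then $(W_c,S_c)$ is a global minimum of $J$. (b) If $q=k<m$ and $(W_c,S_c)$ is not maximal, then $(W_c,S_c)$ is a strict saddle with $$\lambda_{\min}(\nabla^2J(W_c,S_c))=-\frac{\sigma_p^2-\lambda_k^2}{\frac{\lambda_k^2+1}{2}+\sqrt{\sigma_p^2+\left(\frac{\lambda_k^2-1}{2}\right)^2}}.$$ (c) If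 $q<\min\{k,m\}$, then $$\lambda_{\min}(\nabla^2J(W_c,S_c))=\begin{cases}\frac{\omega_{k-q}}2-\sqrt{\sigma_{q+1}^2+\left(\frac{\omega_{k-q}}2\right)^2}, & (W_c,S_c)\text{ maximal};\\[4pt] \min\left\{\frac{\omega_{k-q}}2-\sqrt{\sigma_p^2+\left(\frac{\omega_{k-q}}2\right)^2},\ \frac12\left(\lambda_q^2+1-\sqrt{(\lambda_q^2-1)^2+4\sigma_p^2}\right)\right\}, & \text{otherwise},\end{cases}$$ and $(W_c,S_c)$ is a strict saddle, except in the degenerate case that it is maximal and $\sigma_{q+1}=0$, in which it is a global minimum of $J$. -/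

import Mathlib

namespace MatFact

noncomputable section

/-- The space of pairs `(W, S)` of an `m × k` and a `k × n` real matrix, with the inner product
`⟪(G, H), (G', H')⟫ = ⟪G, G'⟫ + ⟪H, H'⟫` built from the standard (Frobenius) inner products. -/
abbrev PairSpace (m k n : ℕ) : Type :=
  WithLp 2 (EuclideanSpace ℝ (Fin m × Fin k) × EuclideanSpace ℝ (Fin k × Fin n))

variable {m n k q : ℕ}

/-- The point `(W, S)` of `PairSpace m k n`. -/
def pair (W : Matrix (Fin m) (Fin k) ℝ) (S : Matrix (Fin k) (Fin n) ℝ) : PairSpace m k n :=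
  WithLp.toLp 2
    (WithLp.toLp 2 (fun ij => W ij.1 ij.2), WithLp.toLp 2 (fun ij => S ij.1 ij.2))

/-- The factor `W` of a point of `PairSpace m k n`. -/
def PairSpace.W (x : PairSpace m k n) : Matrix (Fin m) (Fin k) ℝ :=
  Matrix.of fun i j => x.fst (i, j)

/-- The factor `S` of a point of `PairSpace m k n`. -/
def PairSpace.S (x : PairSpace m k n) : Matrix (Fin k) (Fin n) ℝ :=
  Matrix.of fun i j => x.snd (i, j)

/-- The objective `J(W, S) = ½ ‖X - W S‖_F²`. -/
def J (X : Matrix (Fin m) (Fin n) ℝ) (x : PairSpace m k n) : ℝ :=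
  (1 / 2) * ∑ i, ∑ j, ((X - x.W * x.S) i j) ^ 2

section Landscape

variable {E : Type*} [NormedAddCommGroup E] [InnerProductSpace ℝ E] [CompleteSpace E]

/-- The Hessian map of `f` at `x`: the derivative of the gradient field of `f`. -/
def hessian (f : E → ℝ) (x : E) : Module.End ℝ E :=
  (fderiv ℝ (gradient f) x : E →L[ℝ] E).toLinearMap

/-- `ρ` is the least real eigenvalue of the linear map `T`. -/
def IsMinEigenvalue {F : Type*} [AddCommGroup F] [Module ℝ F]
    (T : Module.End ℝ F) (ρ : ℝ) : Prop :=
  IsLeast {μ : ℝ | T.HasEigenvalue μ} ρ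

/-- A strict saddle: a critical point at which the Hessian map has a negative eigenvalue. -/
def IsStrictSaddle (f : E → ℝ) (x : E) : Prop :=
  gradient f x = 0 ∧ ∃ μ : ℝ, μ < 0 ∧ (hessian f x).HasEigenvalue μ

/-- A global minimum of `f`. -/
def IsGlobalMin (f : E → ℝ) (x : E) : Prop := ∀ y, f x ≤ f y

end Landscape

/-- The `m × n` matrix with `σ` on its main diagonal and zeros elsewhere. -/
def rectDiagonal (m n : ℕ) (σ : Fin m → ℝ) : Matrix (Fin m) (Fin n) ℝ :=
  Matrix.of fun i j => if (i : ℕ) = (j : ℕ) then σ i else 0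

/-- A full singular value decomposition `X = U Σ Vᵀ`; `σ 0 ≥ σ 1 ≥ ⋯ ≥ 0` are the singular values,
continued by zeros up to length `m` (the condition `sigma_eq_zero` is void if `m ≤ n`). -/
structure FullSVD (X : Matrix (Fin m) (Fin n) ℝ) where
  U : Matrix (Fin m) (Fin m) ℝ
  V : Matrix (Fin n) (Fin n) ℝ
  σ : Fin m → ℝ
  U_mem : U ∈ Matrix.orthogonalGroup (Fin m) ℝ
  V_mem : V ∈ Matrix.orthogonalGroup (Fin n) ℝ
  sigma_antitone : Antitone σ
  sigma_nonneg : ∀ i, 0 ≤ σ i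
  sigma_eq_zero : ∀ i : Fin m, n ≤ (i : ℕ) → σ i = 0
  eq_mul : X = U * rectDiagonal m n σ * V.transpose

namespace FullSVD

variable {X : Matrix (Fin m) (Fin n) ℝ}

/-- The selected singular values `λ 0, …, λ (q-1)`; `sel j` is the position in the singular value
decomposition of the `j`-th selected one. -/
def lam (D : FullSVD X) (sel : Fin q ↪ Fin m) (j : Fin q) : ℝ := D.σ (sel j)

/-- The matrix `Ū` of the selected left singular vectors. -/
def Ubar (D : FullSVD X) (sel : Fin q ↪ Fin m) : Matrix (Fin m) (Fin q) ℝ :=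
  Matrix.of fun a j => D.U a (sel j)

/-- The matrix `V̄` of the right singular vectors that match the columns of `Ū`. If `m ≤ n`, then
the condition in the `if` always holds; if `n < m`, a left singular vector beyond the `n`-th has no
partner, its singular value is `0`, and the column is irrelevant (it is set to zero). -/
def Vbar (D : FullSVD X) (sel : Fin q ↪ Fin m) : Matrix (Fin n) (Fin q) ℝ :=
  Matrix.of fun b j => if h : (sel j : ℕ) < n then D.V b ⟨sel j, h⟩ else 0

/-- The matrix `V₀` of the right singular vectors `v_{r+1}, …, v_n`, where `r = rank X`. -/
def V0 (D : FullSVD X) : Matrix (Fin n) (Fin (n - X.rank)) ℝ :=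
  Matrix.of fun b i => D.V b ⟨X.rank + i, by have := i.isLt; omega⟩

end FullSVD

/-- The first `q` of `k` indices, followed by the other `k - q`. -/
def splitIndex (hqk : q ≤ k) : Fin k ≃ Fin q ⊕ Fin (k - q) :=
  (finCongr (show k = q + (k - q) by omega)).trans finSumFinEquiv.symm

/-- The point `(W_c, S_c)`, with the blocks `W_c = [Ū 0]` and `S_c = [Λ V̄ᵀ ; C₀ᵀ V₀ᵀ]`. -/
def canonicalPoint {X : Matrix (Fin m) (Fin n) ℝ} (D : FullSVD X) (hqk : q ≤ k)
    (sel : Fin q ↪ Fin m) (C₀ : Matrix (Fin (n - X.rank)) (Fin (k - q)) ℝ) :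
    PairSpace m k n :=
  pair
    ((Matrix.fromCols (D.Ubar sel) (0 : Matrix (Fin m) (Fin (k - q)) ℝ)).submatrix
      id (splitIndex hqk))
    ((Matrix.fromRows (Matrix.diagonal (D.lam sel) * (D.Vbar sel).transpose)
      (C₀.transpose * D.V0.transpose)).submatrix (splitIndex hqk) id)

/-- The canonical point is maximal: `λ j = σ j` for each of the `q` selected singular values. -/
def IsMaximal {X : Matrix (Fin m) (Fin n) ℝ} (D : FullSVD X) (hqm : q ≤ m)
    (sel : Fin q ↪ Fin m) : Prop :=
  ∀ j : Fin q, D.lam sel j = D.σ (Fin.castLE hqm j)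

/-- `p` is the least index with `λ p < σ p`. -/
def IsFirstGap {X : Matrix (Fin m) (Fin n) ℝ} (D : FullSVD X) (hqm : q ≤ m)
    (sel : Fin q ↪ Fin m) (p : Fin q) : Prop :=
  IsLeast {j : Fin q | D.lam sel j < D.σ (Fin.castLE hqm j)} p

end

end MatFact

namespace MatFact

open Matrix

section PairSpace

variable {m n k : ℕ}

@[simp] lemma pair_W (W : Matrix (Fin m) (Fin k) ℝ) (S : Matrix (Fin k) (Fin n) ℝ) :
    (pair W S).W = W := rfl

@[simp] lemma pair_S (W : Matrix (Fin m) (Fin k) ℝ) (S : Matrix (Fin k) (Fin n) ℝ) :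
    (pair W S).S = S := rfl

@[simp] lemma PairSpace.add_W (x y : PairSpace m k n) : (x + y).W = x.W + y.W := rfl

@[simp] lemma PairSpace.add_S (x y : PairSpace m k n) : (x + y).S = x.S + y.S := rfl

@[simp] lemma PairSpace.smul_W (c : ℝ) (x : PairSpace m k n) : (c • x).W = c • x.W := rfl

@[simp] lemma PairSpace.smul_S (c : ℝ) (x : PairSpace m k n) : (c • x).S = c • x.S := rfl

lemma pair_add_pair (W W' : Matrix (Fin m) (Fin k) ℝ) (S S' : Matrix (Fin k) (Fin n) ℝ) :
    pair W S + pair W' S' = pair (W + W') (S + S') := rfl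

lemma smul_pair (c : ℝ) (W : Matrix (Fin m) (Fin k) ℝ) (S : Matrix (Fin k) (Fin n) ℝ) :
    c • pair W S = pair (c • W) (c • S) := rfl

lemma pair_zero_zero : pair (0 : Matrix (Fin m) (Fin k) ℝ) (0 : Matrix (Fin k) (Fin n) ℝ) = 0 :=
  rfl

lemma inner_pairSpace (x y : PairSpace m k n) :
    inner ℝ x y = ∑ i, ∑ j, x.W i j * y.W i j + ∑ i, ∑ j, x.S i j * y.S i j := by
  rw [WithLp.prod_inner_apply, PiLp.inner_apply, PiLp.inner_apply, Fintype.sum_prod_type,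
    Fintype.sum_prod_type]
  simp [PairSpace.W, PairSpace.S, mul_comm]

/-- The entry `(i, j)` of the first factor, as a continuous linear functional. -/
noncomputable def entryW (i : Fin m) (j : Fin k) : PairSpace m k n →L[ℝ] ℝ :=
  (EuclideanSpace.proj (i, j)).comp (WithLp.fstL 2 ℝ _ _)

/-- The entry `(i, j)` of the second factor, as a continuous linear functional. -/
noncomputable def entryS (i : Fin k) (j : Fin n) : PairSpace m k n →L[ℝ] ℝ :=
  (EuclideanSpace.proj (i, j)).comp (WithLp.sndL 2 ℝ _ _)

@[simp] lemma entryW_apply (i : Fin m) (j : Fin k) (x : PairSpace m k n) :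
    entryW i j x = x.W i j := rfl

@[simp] lemma entryS_apply (i : Fin k) (j : Fin n) (x : PairSpace m k n) :
    entryS i j x = x.S i j := rfl

lemma hasFDerivAt_pairSpace {E : Type*} [NormedAddCommGroup E] [NormedSpace ℝ E]
    {f : E → PairSpace m k n} {L : E →L[ℝ] PairSpace m k n} {x : E}
    (hW : ∀ i j, HasFDerivAt (fun y => (f y).W i j) ((entryW i j).comp L) x)
    (hS : ∀ i j, HasFDerivAt (fun y => (f y).S i j) ((entryS i j).comp L) x) :
    HasFDerivAt f L x := by
  rw [← (WithLp.prodContinuousLinearEquiv 2 ℝ _ _).comp_hasFDerivAt_iff]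
  refine HasFDerivAt.prodMk (f₁ := fun y => (f y).fst) (f₂ := fun y => (f y).snd)
    (f₁' := (WithLp.fstL 2 ℝ _ _).comp L) (f₂' := (WithLp.sndL 2 ℝ _ _).comp L) ?_ ?_
  · exact hasFDerivWithinAt_univ.1 <|
      hasFDerivWithinAt_euclidean.2 fun ij => (hW ij.1 ij.2).hasFDerivWithinAt
  · exact hasFDerivWithinAt_univ.1 <|
      hasFDerivWithinAt_euclidean.2 fun ij => (hS ij.1 ij.2).hasFDerivWithinAt

end PairSpace

section EntryDeriv

variable {E : Type*} [NormedAddCommGroup E] [NormedSpace ℝ E] {ι κ τ : Type*}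

/-- Every entry of the matrix-valued map `A` is differentiable at `x`, and the derivative in the
direction `y` is the corresponding entry of `A' y`. -/
def HasEntryFDerivAt (A : E → Matrix ι κ ℝ) (A' : E → Matrix ι κ ℝ) (x : E) : Prop :=
  ∀ i j, ∃ L : E →L[ℝ] ℝ, HasFDerivAt (fun y => A y i j) L x ∧ ∀ y, L y = A' y i j

lemma HasEntryFDerivAt.const (A : Matrix ι κ ℝ) (x : E) :
    HasEntryFDerivAt (fun _ => A) (fun _ => 0) x := fun _ _ =>
  ⟨0, hasFDerivAt_const _ _, fun _ => rfl⟩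

variable {A A' B B' : E → Matrix ι κ ℝ} {x : E}

lemma HasEntryFDerivAt.sub (hA : HasEntryFDerivAt A A' x) (hB : HasEntryFDerivAt B B' x) :
    HasEntryFDerivAt (fun y => A y - B y) (fun y => A' y - B' y) x := fun i j => by
  obtain ⟨L, hL, hL'⟩ := hA i j
  obtain ⟨M, hM, hM'⟩ := hB i j
  exact ⟨L - M, hL.sub hM, fun y => by simp [hL', hM']⟩

lemma HasEntryFDerivAt.neg (hA : HasEntryFDerivAt A A' x) :
    HasEntryFDerivAt (fun y => -A y) (fun y => -A' y) x := fun i j => by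
  obtain ⟨L, hL, hL'⟩ := hA i j
  exact ⟨-L, hL.neg, fun y => by simp [hL']⟩

lemma HasEntryFDerivAt.transpose (hA : HasEntryFDerivAt A A' x) :
    HasEntryFDerivAt (fun y => (A y)ᵀ) (fun y => (A' y)ᵀ) x := fun i j => hA j i

lemma HasEntryFDerivAt.mul [Fintype κ] {C C' : E → Matrix κ τ ℝ} (hA : HasEntryFDerivAt A A' x)
    (hC : HasEntryFDerivAt C C' x) :
    HasEntryFDerivAt (fun y => A y * C y) (fun y => A' y * C x + A x * C' y) x := fun i j => by
  choose L hL hL' using fun l => hA i l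
  choose M hM hM' using fun l => hC l j
  refine ⟨∑ l, (A x i l • M l + C x l j • L l),
    HasFDerivAt.fun_sum fun l _ => (hL l).mul (hM l), fun y => ?_⟩
  simp [hL', hM', Matrix.mul_apply, Finset.sum_add_distrib, mul_comm, add_comm]

end EntryDeriv

section Derivatives

variable {m n k : ℕ} (X : Matrix (Fin m) (Fin n) ℝ) (x : PairSpace m k n)

lemma hasEntryFDerivAt_W :
    HasEntryFDerivAt (PairSpace.W : PairSpace m k n → _) PairSpace.W x := fun i j =>
  ⟨entryW i j, (entryW i j).hasFDerivAt, fun _ => rfl⟩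

lemma hasEntryFDerivAt_S :
    HasEntryFDerivAt (PairSpace.S : PairSpace m k n → _) PairSpace.S x := fun i j =>
  ⟨entryS i j, (entryS i j).hasFDerivAt, fun _ => rfl⟩

lemma hasEntryFDerivAt_residual :
    HasEntryFDerivAt (fun y : PairSpace m k n => X - y.W * y.S)
      (fun y => 0 - (y.W * x.S + x.W * y.S)) x :=
  (HasEntryFDerivAt.const X x).sub ((hasEntryFDerivAt_W x).mul (hasEntryFDerivAt_S x))

lemma sum_mul_mul_transpose {ι κ τ : Type*} [Fintype ι] [Fintype κ] [Fintype τ]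
    (A : Matrix ι τ ℝ) (B : Matrix τ κ ℝ) (C : Matrix ι κ ℝ) :
    ∑ i, ∑ j, C i j * (A * B) i j = ∑ i, ∑ l, (C * Bᵀ) i l * A i l := by
  refine Finset.sum_congr rfl fun i _ => ?_
  simp only [Matrix.mul_apply, Finset.mul_sum, Finset.sum_mul, Matrix.transpose_apply]
  rw [Finset.sum_comm]
  exact Finset.sum_congr rfl fun l _ => Finset.sum_congr rfl fun j _ => by ring

lemma sum_mul_transpose_mul {ι κ τ : Type*} [Fintype ι] [Fintype κ] [Fintype τ]
    (A : Matrix ι τ ℝ) (B : Matrix τ κ ℝ) (C : Matrix ι κ ℝ) :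
    ∑ i, ∑ j, C i j * (A * B) i j = ∑ l, ∑ j, (Aᵀ * C) l j * B l j := by
  rw [Finset.sum_comm, Finset.sum_comm (γ := τ)]
  refine Finset.sum_congr rfl fun j _ => ?_
  simp only [Matrix.mul_apply, Finset.mul_sum, Finset.sum_mul, Matrix.transpose_apply]
  rw [Finset.sum_comm]
  exact Finset.sum_congr rfl fun l _ => Finset.sum_congr rfl fun i _ => by ring

lemma hasGradientAt_J :
    HasGradientAt (J X)
      (pair (-((X - x.W * x.S) * x.Sᵀ)) (-(x.Wᵀ * (X - x.W * x.S)))) x := by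
  choose L hL hL' using hasEntryFDerivAt_residual X x
  have h : HasFDerivAt (J X) _ x :=
    (HasFDerivAt.fun_sum fun i (_ : i ∈ Finset.univ) =>
      HasFDerivAt.fun_sum fun j (_ : j ∈ Finset.univ) => (hL i j).pow 2).const_mul (1 / 2 : ℝ)
  rw [hasGradientAt_iff_hasFDerivAt]
  refine h.congr_fderiv (ContinuousLinearMap.ext fun y => ?_)
  rw [InnerProductSpace.toDual_apply_apply, inner_pairSpace]
  simp only [pair_W, pair_S, Matrix.neg_apply, neg_mul, Finset.sum_neg_distrib]
  rw [← sum_mul_mul_transpose, ← sum_mul_transpose_mul, ← neg_add, ← Finset.sum_add_distrib]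
  simp only [_root_.smul_apply, _root_.sum_apply, hL', smul_eq_mul,
    Finset.mul_sum, ← Finset.sum_add_distrib, ← Finset.sum_neg_distrib]
  refine Finset.sum_congr rfl fun i _ => Finset.sum_congr rfl fun j _ => ?_
  simp only [Matrix.sub_apply, Matrix.add_apply, Matrix.zero_apply]
  norm_num
  ring

lemma gradient_J :
    gradient (J X) = fun x : PairSpace m k n =>
      pair (-((X - x.W * x.S) * x.Sᵀ)) (-(x.Wᵀ * (X - x.W * x.S))) :=
  gradient_eq fun x => hasGradientAt_J X x

lemma exists_continuousLinearMap_eq {E : Type*} [NormedAddCommGroup E] [InnerProductSpace ℝ E]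
    [FiniteDimensional ℝ E] (f : E →ₗ[ℝ] E) : ∃ g : E →L[ℝ] E, ∀ x, g x = f x :=
  ⟨LinearMap.toContinuousLinearMap f, fun _ => rfl⟩

lemma hessian_eq_of_hasFDerivAt {E : Type*} [NormedAddCommGroup E] [InnerProductSpace ℝ E]
    [CompleteSpace E] {f : E → ℝ} {x : E} {T : E →L[ℝ] E} {A : E →ₗ[ℝ] E}
    (h : HasFDerivAt (gradient f) T x) (hT : ∀ y, T y = A y) : hessian f x = A := by
  rw [hessian, h.fderiv]
  exact LinearMap.ext hT

/-- The Hessian map of `J X` at `x`. -/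
def hessianMap : PairSpace m k n →ₗ[ℝ] PairSpace m k n where
  toFun y := pair ((y.W * x.S + x.W * y.S) * x.Sᵀ - (X - x.W * x.S) * y.Sᵀ)
    (x.Wᵀ * (y.W * x.S + x.W * y.S) - y.Wᵀ * (X - x.W * x.S))
  map_add' y z := by
    simp only [pair_add_pair, PairSpace.add_W, PairSpace.add_S, Matrix.transpose_add,
      Matrix.add_mul, Matrix.mul_add]
    congr 1 <;> abel
  map_smul' c y := by
    simp only [smul_pair, PairSpace.smul_W, PairSpace.smul_S, Matrix.transpose_smul,
      Matrix.smul_mul, Matrix.mul_smul, ← smul_add, ← smul_sub, RingHom.id_apply]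

lemma hessianMap_apply (y : PairSpace m k n) :
    hessianMap X x y = pair ((y.W * x.S + x.W * y.S) * x.Sᵀ - (X - x.W * x.S) * y.Sᵀ)
      (x.Wᵀ * (y.W * x.S + x.W * y.S) - y.Wᵀ * (X - x.W * x.S)) := rfl

lemma hessian_J : hessian (J X) x = hessianMap X x := by
  obtain ⟨T, hT⟩ := exists_continuousLinearMap_eq (hessianMap X x)
  have h : HasFDerivAt (gradient (J X)) T x := by
    rw [gradient_J]
    refine hasFDerivAt_pairSpace (fun i j => ?_) (fun i j => ?_)
    · obtain ⟨L, hL, hL'⟩ :=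
        (((hasEntryFDerivAt_residual X x).mul (hasEntryFDerivAt_S x).transpose).neg) i j
      refine hL.congr_fderiv (ContinuousLinearMap.ext fun y => ?_)
      rw [hL', ContinuousLinearMap.comp_apply, hT,
        hessianMap_apply, entryW_apply, pair_W]
      refine congrFun (congrFun (?_ : _ = _) i) j
      simp only [zero_sub, Matrix.neg_mul]
      abel
    · obtain ⟨L, hL, hL'⟩ :=
        (((hasEntryFDerivAt_W x).transpose.mul (hasEntryFDerivAt_residual X x)).neg) i j
      refine hL.congr_fderiv (ContinuousLinearMap.ext fun y => ?_)
      rw [hL', ContinuousLinearMap.comp_apply, hT,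
        hessianMap_apply, entryS_apply, pair_S]
      refine congrFun (congrFun (?_ : _ = _) i) j
      simp only [zero_sub, Matrix.mul_neg]
      abel
  exact hessian_eq_of_hasFDerivAt h hT

lemma inner_hessian_J (y : PairSpace m k n) :
    inner ℝ (hessian (J X) x y) y = ∑ i, ∑ j, (y.W * x.S + x.W * y.S) i j ^ 2
      - 2 * ∑ i, ∑ j, (X - x.W * x.S) i j * (y.W * y.S) i j := by
  rw [hessian_J, hessianMap_apply, inner_pairSpace]
  generalize X - x.W * x.S = R
  simp only [pair_W, pair_S, Matrix.sub_apply, sub_mul, Finset.sum_sub_distrib]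
  rw [← sum_mul_mul_transpose, ← sum_mul_mul_transpose, ← sum_mul_transpose_mul,
    ← sum_mul_transpose_mul]
  simp only [sq, two_mul, Matrix.add_apply, mul_add, add_mul, Finset.sum_add_distrib]
  ring

end Derivatives

namespace FullSVD

variable {m n k q : ℕ} {X : Matrix (Fin m) (Fin n) ℝ} (D : FullSVD X)

/-- The left singular vectors. -/
def leftVec (i : Fin m) : Fin m → ℝ := fun a => D.U a i

/-- The right singular vectors, continued by zero. -/
def rightVec (i : Fin m) : Fin n → ℝ := fun b => if h : (i : ℕ) < n then D.V b ⟨i, h⟩ else 0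

lemma leftVec_dotProduct (i j : Fin m) :
    D.leftVec i ⬝ᵥ D.leftVec j = if i = j then 1 else 0 := by
  have h := congrFun (congrFun ((mem_orthogonalGroup_iff' _ _).1 D.U_mem) i) j
  rw [Matrix.one_apply] at h
  exact h

lemma V_dotProduct (i j : Fin n) :
    (fun b => D.V b i) ⬝ᵥ (fun b => D.V b j) = if i = j then 1 else 0 := by
  have h := congrFun (congrFun ((mem_orthogonalGroup_iff' _ _).1 D.V_mem) i) j
  rw [Matrix.one_apply] at h
  exact h

lemma lt_of_sigma_ne_zero {i : Fin m} (h : D.σ i ≠ 0) : (i : ℕ) < n := by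
  by_contra hi
  exact h (D.sigma_eq_zero i (not_lt.1 hi))

lemma rightVec_of_lt {i : Fin m} (h : (i : ℕ) < n) : D.rightVec i = fun b => D.V b ⟨i, h⟩ := by
  ext b
  simp [rightVec, h]

lemma rightVec_dotProduct {i : Fin m} (hi : D.σ i ≠ 0) (j : Fin m) :
    D.rightVec j ⬝ᵥ D.rightVec i = if j = i then 1 else 0 := by
  have hi' := D.lt_of_sigma_ne_zero hi
  by_cases hj : (j : ℕ) < n
  · rw [D.rightVec_of_lt hi', D.rightVec_of_lt hj, V_dotProduct]
    simp [Fin.ext_iff]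
  · have h0 : D.rightVec j = 0 := by ext b; simp [rightVec, hj]
    have hne : j ≠ i := fun h => hj (h ▸ hi')
    rw [h0, zero_dotProduct, if_neg hne]

lemma eq_sum_vecMulVec : X = ∑ i, D.σ i • vecMulVec (D.leftVec i) (D.rightVec i) := by
  conv_lhs => rw [D.eq_mul]
  ext a b
  simp only [Matrix.mul_apply, Matrix.sum_apply, Matrix.smul_apply, vecMulVec_apply,
    Matrix.transpose_apply, Finset.sum_mul, smul_eq_mul]
  rw [Finset.sum_comm]
  refine Finset.sum_congr rfl fun i _ => ?_
  by_cases h : (i : ℕ) < n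
  · rw [Finset.sum_eq_single ⟨i, h⟩]
    · simp [rectDiagonal, leftVec, rightVec, h]
      ring
    · intro l _ hl
      have : (i : ℕ) ≠ l := fun hh => hl (Fin.ext hh.symm)
      simp [rectDiagonal, this]
    · simp
  · rw [Finset.sum_eq_zero]
    · simp [rightVec, h]
    · intro l _
      have : (i : ℕ) ≠ l := by omega
      simp [rectDiagonal, this]

lemma lt_rank_of_sigma_ne_zero {i : Fin m} (h : D.σ i ≠ 0) : (i : ℕ) < X.rank := by
  have hn := D.lt_of_sigma_ne_zero h
  have him : (i : ℕ) + 1 ≤ m := i.isLt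
  have hrect : D.Uᵀ * X * D.V = rectDiagonal m n D.σ := by
    have hU : D.Uᵀ * D.U = 1 := (mem_orthogonalGroup_iff' _ _).1 D.U_mem
    have hV : D.Vᵀ * D.V = 1 := (mem_orthogonalGroup_iff' _ _).1 D.V_mem
    calc _ = D.Uᵀ * (D.U * rectDiagonal m n D.σ * D.Vᵀ) * D.V := by congr 2; exact D.eq_mul
      _ = (D.Uᵀ * D.U) * rectDiagonal m n D.σ * (D.Vᵀ * D.V) := by
          simp only [Matrix.mul_assoc]
      _ = _ := by rw [hU, hV, Matrix.one_mul, Matrix.mul_one]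
  have hsub : (rectDiagonal m n D.σ).submatrix (Fin.castLE him) (Fin.castLE hn)
      = diagonal fun j : Fin (i + 1) => D.σ (Fin.castLE him j) := by
    ext a b
    simp [rectDiagonal, Matrix.diagonal_apply, Fin.ext_iff]
  have hdet : (diagonal fun j : Fin (i + 1) => D.σ (Fin.castLE him j)).det ≠ 0 := by
    rw [det_diagonal, Finset.prod_ne_zero_iff]
    intro j _ h0
    have hle : D.σ i ≤ D.σ (Fin.castLE him j) :=
      D.sigma_antitone (Fin.le_def.2 (Nat.lt_succ_iff.1 j.isLt))
    exact h (le_antisymm (hle.trans_eq h0) (D.sigma_nonneg i))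
  have h1 := rank_of_det_ne_zero hdet
  rw [Fintype.card_fin, ← hsub, ← hrect] at h1
  have h2 := rank_submatrix_le (D.Uᵀ * X * D.V) (Fin.castLE him) (Fin.castLE hn)
  have h3 := (rank_mul_le_left (D.Uᵀ * X) D.V).trans (rank_mul_le_right D.Uᵀ X)
  omega

lemma V0_transpose_mulVec_rightVec {i : Fin m} (h : D.σ i ≠ 0) :
    D.V0ᵀ *ᵥ D.rightVec i = 0 := by
  ext t
  have hr := D.lt_rank_of_sigma_ne_zero h
  rw [D.rightVec_of_lt (D.lt_of_sigma_ne_zero h)]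
  refine (D.V_dotProduct _ _).trans (if_neg ?_)
  simp only [Fin.ext_iff]
  omega

lemma V0_transpose_mul_V0 : D.V0ᵀ * D.V0 = 1 := by
  ext s t
  refine (D.V_dotProduct _ _).trans ?_
  simp [Matrix.one_apply, Fin.ext_iff]

end FullSVD

section CanonicalPoint

variable {m n k q : ℕ} {X : Matrix (Fin m) (Fin n) ℝ} (D : FullSVD X) (hqk : q ≤ k)
  (sel : Fin q ↪ Fin m) (C₀ : Matrix (Fin (n - X.rank)) (Fin (k - q)) ℝ)

local notation "xc" => canonicalPoint D hqk sel C₀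

lemma canonicalPoint_W : (xc).W = (fromCols (D.Ubar sel) 0).submatrix id (splitIndex hqk) := rfl

lemma canonicalPoint_S : (xc).S = (fromRows (diagonal (D.lam sel) * (D.Vbar sel)ᵀ)
    (C₀ᵀ * D.V0ᵀ)).submatrix (splitIndex hqk) id := rfl

lemma canonicalPoint_W_transpose_mulVec (y : Fin m → ℝ) :
    (xc).Wᵀ *ᵥ y = Sum.elim (fun j => D.leftVec (sel j) ⬝ᵥ y) 0 ∘ splitIndex hqk := by
  ext l
  simp only [canonicalPoint_W, Matrix.mulVec, Function.comp, Matrix.transpose_submatrix]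
  cases h : splitIndex hqk l with
  | inl j => simp [dotProduct, h, FullSVD.Ubar, FullSVD.leftVec]
  | inr j => simp [dotProduct, h]

lemma canonicalPoint_S_mulVec (y : Fin n → ℝ) :
    (xc).S *ᵥ y = Sum.elim (fun j => D.lam sel j * (D.rightVec (sel j) ⬝ᵥ y))
      (C₀ᵀ *ᵥ (D.V0ᵀ *ᵥ y)) ∘ splitIndex hqk := by
  have h : (xc).S *ᵥ y = (fromRows (diagonal (D.lam sel) * (D.Vbar sel)ᵀ)
    (C₀ᵀ * D.V0ᵀ) *ᵥ y) ∘ splitIndex hqk := rfl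
  rw [h, fromRows_mulVec, ← mulVec_mulVec, ← mulVec_mulVec]
  congr 2
  ext j
  rw [mulVec_diagonal]
  rfl

lemma canonicalPoint_W_transpose_mulVec_leftVec {i : Fin m} (hi : i ∉ Set.range sel) :
    (xc).Wᵀ *ᵥ D.leftVec i = 0 := by
  rw [canonicalPoint_W_transpose_mulVec]
  ext l
  simp only [Function.comp]
  cases splitIndex hqk l with
  | inl j =>
    have : sel j ≠ i := fun h => hi ⟨j, h⟩
    simp [FullSVD.leftVec_dotProduct, this]
  | inr j => rfl

lemma canonicalPoint_W_transpose_mulVec_leftVec_sel (j : Fin q) :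
    (xc).Wᵀ *ᵥ D.leftVec (sel j) = Pi.single ((splitIndex hqk).symm (Sum.inl j)) 1 := by
  rw [canonicalPoint_W_transpose_mulVec]
  ext l
  obtain ⟨s, rfl⟩ := (splitIndex hqk).symm.surjective l
  simp only [Function.comp, Equiv.apply_symm_apply, Pi.single_apply,
    (splitIndex hqk).symm.injective.eq_iff]
  cases s <;> simp [FullSVD.leftVec_dotProduct]

lemma canonicalPoint_S_mulVec_rightVec {i : Fin m} (hi : i ∉ Set.range sel) (h0 : D.σ i ≠ 0) :
    (xc).S *ᵥ D.rightVec i = 0 := by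
  rw [canonicalPoint_S_mulVec, D.V0_transpose_mulVec_rightVec h0]
  ext l
  simp only [Function.comp]
  cases splitIndex hqk l with
  | inl j =>
    have : sel j ≠ i := fun h => hi ⟨j, h⟩
    simp [D.rightVec_dotProduct h0, this]
  | inr j => simp

lemma canonicalPoint_S_transpose_mulVec (c : Fin k → ℝ) :
    (xc).Sᵀ *ᵥ c = ∑ j, (D.lam sel j * c ((splitIndex hqk).symm (Sum.inl j))) • D.rightVec (sel j)
      + D.V0 *ᵥ (C₀ *ᵥ fun a => c ((splitIndex hqk).symm (Sum.inr a))) := by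
  ext b
  simp only [canonicalPoint_S, Matrix.mulVec, dotProduct, Matrix.transpose_apply,
    Matrix.submatrix_apply, id]
  rw [← (splitIndex hqk).symm.sum_comp, Fintype.sum_sum_type]
  simp only [Equiv.apply_symm_apply, fromRows_apply_inl, fromRows_apply_inr, diagonal_mul,
    Pi.add_apply, Finset.sum_apply, Pi.smul_apply, smul_eq_mul]
  congr 1
  · refine Finset.sum_congr rfl fun j _ => ?_
    simp only [FullSVD.Vbar, FullSVD.rightVec, Matrix.transpose_apply, Matrix.of_apply]
    ring
  · simp only [Matrix.mul_apply, Finset.sum_mul, Finset.mul_sum, Matrix.transpose_apply,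
      Matrix.mulVec, dotProduct]
    rw [Finset.sum_comm]
    exact Finset.sum_congr rfl fun j _ => Finset.sum_congr rfl fun l _ => by ring

lemma canonicalPoint_S_mul_transpose_mulVec (c : Fin k → ℝ) :
    (xc).S *ᵥ ((xc).Sᵀ *ᵥ c)
      = Sum.elim (fun j => D.lam sel j ^ 2 * c ((splitIndex hqk).symm (Sum.inl j)))
        ((C₀ᵀ * C₀) *ᵥ fun a => c ((splitIndex hqk).symm (Sum.inr a))) ∘ splitIndex hqk := by
  rw [canonicalPoint_S_transpose_mulVec, canonicalPoint_S_mulVec]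
  congr 2
  · ext j
    by_cases h0 : D.lam sel j = 0
    · simp [h0]
    · have hV : D.rightVec (sel j) ⬝ᵥ D.V0 *ᵥ (C₀ *ᵥ fun a =>
          c ((splitIndex hqk).symm (Sum.inr a))) = 0 := by
        rw [dotProduct_mulVec, ← mulVec_transpose, D.V0_transpose_mulVec_rightVec h0,
          zero_dotProduct]
      rw [dotProduct_add, hV, dotProduct_sum, Finset.sum_eq_single j]
      · rw [dotProduct_smul, D.rightVec_dotProduct (i := sel j) h0]
        simp
        ring
      · intro i _ hij
        rw [dotProduct_smul, dotProduct_comm, D.rightVec_dotProduct (i := sel j) h0]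
        simp [hij]
      · simp
  · rw [mulVec_add, mulVec_mulVec, D.V0_transpose_mul_V0, one_mulVec, mulVec_sum,
      Finset.sum_eq_zero, zero_add, mulVec_mulVec]
    intro j _
    by_cases h0 : D.lam sel j = 0
    · simp [h0]
    · rw [mulVec_smul, D.V0_transpose_mulVec_rightVec h0, smul_zero]

lemma canonicalPoint_W_mul_S :
    (xc).W * (xc).S = ∑ j, D.lam sel j • vecMulVec (D.leftVec (sel j)) (D.rightVec (sel j)) := by
  rw [canonicalPoint_W, canonicalPoint_S, submatrix_mul_equiv, fromCols_mul_fromRows,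
    Matrix.zero_mul, add_zero, submatrix_id_id, ← Matrix.mul_assoc]
  ext a b
  rw [Matrix.mul_apply]
  simp only [mul_diagonal, Matrix.sum_apply, Matrix.smul_apply, vecMulVec_apply,
    FullSVD.Ubar, FullSVD.Vbar, FullSVD.leftVec, FullSVD.rightVec, Matrix.transpose_apply,
    Matrix.of_apply, smul_eq_mul]
  exact Finset.sum_congr rfl fun j _ => by ring

lemma residual_canonicalPoint :
    X - (xc).W * (xc).S = ∑ i ∈ (Finset.univ.map sel)ᶜ,
      D.σ i • vecMulVec (D.leftVec i) (D.rightVec i) := by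
  rw [canonicalPoint_W_mul_S, sub_eq_iff_eq_add]
  conv_lhs => rw [D.eq_sum_vecMulVec, ← Finset.sum_compl_add_sum (Finset.univ.map sel)]
  rw [Finset.sum_map]
  rfl

lemma residual_mulVec_rightVec {i : Fin m} (hi : i ∉ Set.range sel) (h0 : D.σ i ≠ 0) :
    (X - (xc).W * (xc).S) *ᵥ D.rightVec i = D.σ i • D.leftVec i := by
  rw [residual_canonicalPoint, sum_mulVec, Finset.sum_eq_single i]
  · rw [smul_mulVec, vecMulVec_mulVec, D.rightVec_dotProduct h0]
    simp
  · intro j _ hji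
    rw [smul_mulVec, vecMulVec_mulVec, D.rightVec_dotProduct h0]
    simp [hji]
  · intro h
    simp at h
    exact absurd h hi

lemma residual_transpose_mulVec_leftVec {i : Fin m} (hi : i ∉ Set.range sel) :
    (X - (xc).W * (xc).S)ᵀ *ᵥ D.leftVec i = D.σ i • D.rightVec i := by
  rw [residual_canonicalPoint, transpose_sum, sum_mulVec, Finset.sum_eq_single i]
  · rw [transpose_smul, transpose_vecMulVec, smul_mulVec, vecMulVec_mulVec, D.leftVec_dotProduct]
    simp
  · intro j _ hji
    rw [transpose_smul, transpose_vecMulVec, smul_mulVec, vecMulVec_mulVec, D.leftVec_dotProduct]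
    simp [hji]
  · intro h
    simp at h
    exact absurd h hi

lemma residual_mul_S_transpose : (X - (xc).W * (xc).S) * (xc).Sᵀ = 0 := by
  rw [residual_canonicalPoint, Matrix.sum_mul]
  refine Finset.sum_eq_zero fun i hi => ?_
  by_cases h0 : D.σ i = 0
  · simp [h0]
  · rw [Matrix.smul_mul, vecMulVec_mul, vecMul_transpose,
      canonicalPoint_S_mulVec_rightVec D hqk sel C₀ (by simpa using hi) h0]
    ext a b
    simp [vecMulVec_apply]

lemma W_transpose_mul_residual : (xc).Wᵀ * (X - (xc).W * (xc).S) = 0 := by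
  rw [residual_canonicalPoint, Matrix.mul_sum]
  refine Finset.sum_eq_zero fun i hi => ?_
  rw [Matrix.mul_smul, mul_vecMulVec,
    canonicalPoint_W_transpose_mulVec_leftVec D hqk sel C₀ (by simpa using hi)]
  simp

lemma gradient_canonicalPoint : gradient (J X) (xc) = 0 := by
  rw [gradient_J]
  dsimp only
  rw [residual_mul_S_transpose, W_transpose_mul_residual, neg_zero, neg_zero, pair_zero_zero]

end CanonicalPoint

lemma sum_sum_vecMulVec_mul {ι κ τ : Type*} [Fintype κ] [Fintype τ] (s : Finset ι) (c : ι → ℝ) (u : ι → κ → ℝ) (v : ι → τ → ℝ)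
    (B : Matrix κ τ ℝ) :
    ∑ a, ∑ b, (∑ i ∈ s, c i • vecMulVec (u i) (v i)) a b * B a b
      = ∑ i ∈ s, c i * (u i ⬝ᵥ B *ᵥ v i) := by
  simp only [Matrix.sum_apply, Matrix.smul_apply, vecMulVec_apply, smul_eq_mul, Finset.sum_mul,
    dotProduct, Matrix.mulVec, Finset.mul_sum]
  rw [Finset.sum_comm (s := s)]
  refine Finset.sum_congr rfl fun a _ => ?_
  rw [Finset.sum_comm]
  exact Finset.sum_congr rfl fun i _ => Finset.sum_congr rfl fun b _ => by ring

section Bessel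

variable {ι κ τ : Type*} [DecidableEq ι] [Fintype κ] [Fintype τ]

lemma sum_sq_dotProduct_le (s : Finset ι) (v : ι → κ → ℝ)
    (hv : ∀ i ∈ s, ∀ j ∈ s, v i ⬝ᵥ v j = if i = j then 1 else 0) (x : κ → ℝ) :
    ∑ i ∈ s, (v i ⬝ᵥ x) ^ 2 ≤ x ⬝ᵥ x := by
  set y : κ → ℝ := ∑ i ∈ s, (v i ⬝ᵥ x) • v i with hy
  have hxy : x ⬝ᵥ y = ∑ i ∈ s, (v i ⬝ᵥ x) ^ 2 := by
    rw [hy, dotProduct_sum]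
    refine Finset.sum_congr rfl fun i _ => ?_
    rw [dotProduct_smul, dotProduct_comm, smul_eq_mul, sq]
  have hyy : y ⬝ᵥ y = ∑ i ∈ s, (v i ⬝ᵥ x) ^ 2 := by
    conv_lhs => rw [hy, sum_dotProduct]
    refine Finset.sum_congr rfl fun i hi => ?_
    rw [smul_dotProduct, dotProduct_sum, Finset.sum_eq_single i]
    · rw [dotProduct_smul, hv i hi i hi]
      simp [sq]
    · intro j hj hji
      rw [dotProduct_smul, hv i hi j hj, if_neg hji.symm, smul_zero]
    · exact fun h => absurd hi h
  have h0 : 0 ≤ (x - y) ⬝ᵥ (x - y) := Finset.sum_nonneg fun i _ => mul_self_nonneg _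
  rw [sub_dotProduct, dotProduct_sub, dotProduct_sub, dotProduct_comm y x, hxy, hyy] at h0
  linarith

lemma sum_dotProduct_transpose_mulVec_le (s : Finset ι) (u : ι → κ → ℝ)
    (hu : ∀ i ∈ s, ∀ j ∈ s, u i ⬝ᵥ u j = if i = j then 1 else 0) (A : Matrix κ τ ℝ) :
    ∑ i ∈ s, (Aᵀ *ᵥ u i) ⬝ᵥ (Aᵀ *ᵥ u i) ≤ ∑ a, ∑ b, A a b ^ 2 := by
  simp only [dotProduct]
  rw [Finset.sum_comm, Finset.sum_comm (γ := κ)]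
  refine Finset.sum_le_sum fun b _ => ?_
  have h := sum_sq_dotProduct_le s u hu (fun a => A a b)
  simp only [dotProduct] at h
  calc _ = ∑ i ∈ s, (∑ a, u i a * A a b) ^ 2 := by
        refine Finset.sum_congr rfl fun i _ => ?_
        simp only [Matrix.mulVec, dotProduct, Matrix.transpose_apply, sq, mul_comm]
    _ ≤ _ := h
    _ = _ := by simp only [sq]

lemma sum_dotProduct_mulVec_le (s : Finset ι) (v : ι → τ → ℝ)
    (hv : ∀ i ∈ s, ∀ j ∈ s, v i ⬝ᵥ v j = if i = j then 1 else 0) (A : Matrix κ τ ℝ) :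
    ∑ i ∈ s, (A *ᵥ v i) ⬝ᵥ (A *ᵥ v i) ≤ ∑ a, ∑ b, A a b ^ 2 := by
  rw [Finset.sum_comm]
  exact sum_dotProduct_transpose_mulVec_le s v hv Aᵀ

end Bessel

section LowerBound

lemma quadratic_nonneg {A B s : ℝ} (hA : 0 ≤ A) (hB : 0 ≤ B) (hs : s ^ 2 ≤ A * B) (α β : ℝ) :
    0 ≤ A * α ^ 2 + B * β ^ 2 - 2 * s * (α * β) := by
  rcases hB.eq_or_lt with rfl | hB
  · have : s = 0 := by nlinarith [sq_nonneg s]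
    subst this
    nlinarith [mul_nonneg hA (sq_nonneg α)]
  · refine nonneg_of_mul_nonneg_right (a := B) ?_ hB
    nlinarith [sq_nonneg (B * β - s * α), mul_nonneg (sub_nonneg.2 hs) (sq_nonneg α)]

variable {m n k q : ℕ} {X : Matrix (Fin m) (Fin n) ℝ} (D : FullSVD X) (hqk : q ≤ k)
  (sel : Fin q ↪ Fin m) (C₀ : Matrix (Fin (n - X.rank)) (Fin (k - q)) ℝ)

lemma dotProduct_splitIndex (a b : Fin k → ℝ) :
    a ⬝ᵥ b = ∑ j, a ((splitIndex hqk).symm (Sum.inl j)) * b ((splitIndex hqk).symm (Sum.inl j))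
      + (fun j => a ((splitIndex hqk).symm (Sum.inr j))) ⬝ᵥ
        (fun j => b ((splitIndex hqk).symm (Sum.inr j))) := by
  simp only [dotProduct]
  rw [← (splitIndex hqk).symm.sum_comp, Fintype.sum_sum_type]

local notation "xc" => canonicalPoint D hqk sel C₀

theorem mul_inner_self_le_inner_hessian_canonicalPoint {μ ρ : ℝ} (hρ : ρ ≤ 0)
    (hμ : ∀ i, i ∉ Set.range sel → D.σ i ≤ μ)
    (hlam : ∀ j, μ ^ 2 ≤ (D.lam sel j ^ 2 - ρ) * (1 - ρ))
    (hC : ∀ (c d : Fin (k - q) → ℝ) (s : ℝ), 0 ≤ s → s ≤ μ →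
      0 ≤ c ⬝ᵥ (C₀ᵀ * C₀) *ᵥ c - 2 * s * (c ⬝ᵥ d) - ρ * (c ⬝ᵥ c + d ⬝ᵥ d))
    (y : PairSpace m k n) :
    ρ * inner ℝ y y ≤ inner ℝ (hessian (J X) (xc) y) y := by
  classical
  rw [inner_hessian_J, inner_pairSpace]
  set G := y.W
  set H := y.S
  set W := (xc).W with hW
  set S := (xc).S with hS
  set M := G * S + W * H with hM
  set act : Finset (Fin m) := Finset.univ.filter fun i => i ∉ Set.range sel ∧ D.σ i ≠ 0 with hact
  have mem_act : ∀ i ∈ act, i ∉ Set.range sel ∧ D.σ i ≠ 0 := fun i hi => (Finset.mem_filter.1 hi).2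
  set a : Fin m → Fin k → ℝ := fun i => Gᵀ *ᵥ D.leftVec i with ha
  set b : Fin m → Fin k → ℝ := fun i => H *ᵥ D.rightVec i with hb
  have hu : ∀ s : Finset (Fin m), ∀ i ∈ s, ∀ j ∈ s,
      D.leftVec i ⬝ᵥ D.leftVec j = if i = j then 1 else 0 :=
    fun _ i _ j _ => D.leftVec_dotProduct i j
  have hv : ∀ i ∈ act, ∀ j ∈ act, D.rightVec i ⬝ᵥ D.rightVec j = if i = j then 1 else 0 :=
    fun i _ j hj => D.rightVec_dotProduct (mem_act j hj).2 i
  have hdisj : Disjoint act (Finset.univ.map sel) := by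
    rw [Finset.disjoint_left]
    intro i hi hi'
    obtain ⟨j, -, rfl⟩ := Finset.mem_map.1 hi'
    exact (mem_act _ hi).1 ⟨j, rfl⟩
  have h1 : ∑ i ∈ act, (Mᵀ *ᵥ D.leftVec i) ⬝ᵥ (Mᵀ *ᵥ D.leftVec i)
      + ∑ j, (Mᵀ *ᵥ D.leftVec (sel j)) ⬝ᵥ (Mᵀ *ᵥ D.leftVec (sel j)) ≤ ∑ i, ∑ j, M i j ^ 2 := by
    have h := sum_dotProduct_transpose_mulVec_le (act ∪ Finset.univ.map sel) D.leftVec (hu _) M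
    rwa [Finset.sum_union hdisj, Finset.sum_map] at h
  have h2 : ∀ i ∈ act, (Mᵀ *ᵥ D.leftVec i) ⬝ᵥ (Mᵀ *ᵥ D.leftVec i)
      = ∑ j, D.lam sel j ^ 2 * a i ((splitIndex hqk).symm (Sum.inl j)) ^ 2
        + (fun j => a i ((splitIndex hqk).symm (Sum.inr j))) ⬝ᵥ
          (C₀ᵀ * C₀) *ᵥ (fun j => a i ((splitIndex hqk).symm (Sum.inr j))) := by
    intro i hi
    have hMi : Mᵀ *ᵥ D.leftVec i = Sᵀ *ᵥ a i := by
      rw [hM, Matrix.transpose_add, Matrix.transpose_mul, Matrix.transpose_mul, add_mulVec,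
        ← mulVec_mulVec, ← mulVec_mulVec,
        canonicalPoint_W_transpose_mulVec_leftVec D hqk sel C₀ (mem_act i hi).1, mulVec_zero,
        add_zero]
    rw [hMi, dotProduct_mulVec, vecMul_transpose, canonicalPoint_S_mul_transpose_mulVec,
      dotProduct_splitIndex hqk]
    simp only [Function.comp, Equiv.apply_symm_apply, Sum.elim_inl, Sum.elim_inr]
    congr 1
    · exact Finset.sum_congr rfl fun j _ => by ring
    · rw [dotProduct_comm]
  have h3 : ∀ j, ∑ i ∈ act, b i ((splitIndex hqk).symm (Sum.inl j)) ^ 2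
      ≤ (Mᵀ *ᵥ D.leftVec (sel j)) ⬝ᵥ (Mᵀ *ᵥ D.leftVec (sel j)) := by
    intro j
    refine le_trans (le_of_eq ?_) (sum_sq_dotProduct_le act D.rightVec hv _)
    refine Finset.sum_congr rfl fun i hi => ?_
    congr 1
    rw [dotProduct_mulVec, vecMul_transpose, hM, add_mulVec, ← mulVec_mulVec, ← mulVec_mulVec,
      canonicalPoint_S_mulVec_rightVec D hqk sel C₀ (mem_act i hi).1 (mem_act i hi).2,
      mulVec_zero, zero_add, dotProduct_comm, dotProduct_mulVec, ← mulVec_transpose,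
      canonicalPoint_W_transpose_mulVec_leftVec_sel, single_one_dotProduct]
  have h4 : ∑ i, ∑ j, (X - W * S) i j * (G * H) i j = ∑ i ∈ act, D.σ i * (a i ⬝ᵥ b i) := by
    rw [residual_canonicalPoint, sum_sum_vecMulVec_mul]
    have hsub : act ⊆ (Finset.univ.map sel)ᶜ := fun i hi => by
      simpa using (mem_act i hi).1
    rw [← Finset.sum_subset hsub]
    · refine Finset.sum_congr rfl fun i _ => ?_
      rw [← mulVec_mulVec, dotProduct_mulVec, ← mulVec_transpose]
    · intro i hi hi'
      have h0 : D.σ i = 0 := by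
        by_contra h0
        exact hi' (Finset.mem_filter.2 ⟨Finset.mem_univ _, by simpa using hi, h0⟩)
      rw [h0, zero_mul]
  have h5 := sum_dotProduct_transpose_mulVec_le act D.leftVec (hu _) G
  have h6 := sum_dotProduct_mulVec_le act D.rightVec hv H
  have h3' := Finset.sum_le_sum fun j (_ : j ∈ Finset.univ) => h3 j
  rw [Finset.sum_comm] at h3'
  rw [Finset.sum_congr rfl h2] at h1
  have key : 0 ≤ ∑ i ∈ act, ((∑ j, D.lam sel j ^ 2 * a i ((splitIndex hqk).symm (Sum.inl j)) ^ 2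
        + (fun j => a i ((splitIndex hqk).symm (Sum.inr j))) ⬝ᵥ
          (C₀ᵀ * C₀) *ᵥ (fun j => a i ((splitIndex hqk).symm (Sum.inr j))))
        + ∑ j, b i ((splitIndex hqk).symm (Sum.inl j)) ^ 2
        - 2 * (D.σ i * (a i ⬝ᵥ b i)) - ρ * (a i ⬝ᵥ a i) - ρ * (b i ⬝ᵥ b i)) := by
    refine Finset.sum_nonneg fun i hi => ?_
    have hσ := hμ i (mem_act i hi).1
    have hσ0 := D.sigma_nonneg i
    have hr := hC (fun j => a i ((splitIndex hqk).symm (Sum.inr j)))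
      (fun j => b i ((splitIndex hqk).symm (Sum.inr j))) _ hσ0 hσ
    have hl : 0 ≤ ∑ j, (D.lam sel j ^ 2 * a i ((splitIndex hqk).symm (Sum.inl j)) ^ 2
        + b i ((splitIndex hqk).symm (Sum.inl j)) ^ 2
        - 2 * D.σ i * (a i ((splitIndex hqk).symm (Sum.inl j))
          * b i ((splitIndex hqk).symm (Sum.inl j)))
        - ρ * (a i ((splitIndex hqk).symm (Sum.inl j)) * a i ((splitIndex hqk).symm (Sum.inl j)))
        - ρ * (b i ((splitIndex hqk).symm (Sum.inl j))
          * b i ((splitIndex hqk).symm (Sum.inl j)))) := by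
      refine Finset.sum_nonneg fun j _ => ?_
      generalize a i ((splitIndex hqk).symm (Sum.inl j)) = α
      generalize b i ((splitIndex hqk).symm (Sum.inl j)) = β
      have hs : D.σ i ^ 2 ≤ (D.lam sel j ^ 2 - ρ) * (1 - ρ) :=
        (pow_le_pow_left₀ hσ0 hσ 2).trans (hlam j)
      have := quadratic_nonneg (by nlinarith [sq_nonneg (D.lam sel j)]) (by linarith) hs α β
      linarith
    simp only [Finset.sum_sub_distrib, Finset.sum_add_distrib, ← Finset.mul_sum] at hl
    rw [dotProduct_splitIndex hqk (a i) (b i), dotProduct_splitIndex hqk (a i) (a i),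
      dotProduct_splitIndex hqk (b i) (b i)]
    linarith
  simp only [Finset.sum_sub_distrib, Finset.sum_add_distrib, ← Finset.mul_sum] at key h1
  simp only [← sq]
  have h7 := mul_le_mul_of_nonpos_left h5 hρ
  have h8 := mul_le_mul_of_nonpos_left h6 hρ
  rw [h4]
  linarith

end LowerBound

section Eigenvectors

variable {m n k q : ℕ} {X : Matrix (Fin m) (Fin n) ℝ} (D : FullSVD X) (hqk : q ≤ k)
  (sel : Fin q ↪ Fin m) (C₀ : Matrix (Fin (n - X.rank)) (Fin (k - q)) ℝ)

local notation "xc" => canonicalPoint D hqk sel C₀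

lemma FullSVD.leftVec_ne_zero (i : Fin m) : D.leftVec i ≠ 0 := fun h => by
  have := D.leftVec_dotProduct i i
  simp [h] at this

lemma vecMulVec_ne_zero_of_ne_zero {ι κ : Type*} {u : ι → ℝ} {v : κ → ℝ} (hu : u ≠ 0) (hv : v ≠ 0) :
    vecMulVec u v ≠ 0 := fun h => by
  obtain ⟨i, hi⟩ := Function.ne_iff.1 hu
  obtain ⟨j, hj⟩ := Function.ne_iff.1 hv
  exact mul_ne_zero hi hj (congrFun (congrFun h i) j)

lemma hasEigenvalue_hessian_canonicalPoint {i : Fin m} (hi : i ∉ Set.range sel) (h0 : D.σ i ≠ 0)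
    {f : Fin k → ℝ} (hf : f ≠ 0) {s w ρ : ℝ} (hS : (xc).S *ᵥ ((xc).Sᵀ *ᵥ f) = s • f)
    (hW : (xc).Wᵀ *ᵥ ((xc).W *ᵥ f) = w • f) (hρ : (s - ρ) * (w - ρ) = D.σ i ^ 2) :
    (hessian (J X) (xc)).HasEigenvalue ρ := by
  have hSv := canonicalPoint_S_mulVec_rightVec D hqk sel C₀ hi h0
  have hWu := canonicalPoint_W_transpose_mulVec_leftVec D hqk sel C₀ hi
  have hR := residual_mulVec_rightVec D hqk sel C₀ hi h0
  have hRt := residual_transpose_mulVec_leftVec D hqk sel C₀ hi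
  refine Module.End.hasEigenvalue_of_hasEigenvector (x := pair
    (D.σ i • vecMulVec (D.leftVec i) f) ((s - ρ) • vecMulVec f (D.rightVec i)))
    (Module.End.hasEigenvector_iff.2 ⟨Module.End.mem_eigenspace_iff.2 ?_, ?_⟩)
  · rw [hessian_J, hessianMap_apply, smul_pair]
    simp only [pair_W, pair_S]
    generalize X - (xc).W * (xc).S = R at *
    generalize (xc).W = W at *
    generalize (xc).S = S at *
    have e1 : vecMulVec (D.leftVec i) f * S * Sᵀ = s • vecMulVec (D.leftVec i) f := by
      rw [vecMulVec_mul, vecMulVec_mul, ← mulVec_transpose S, vecMul_transpose, hS]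
      ext a b
      simp [vecMulVec_apply]
      ring
    have e2 : W * vecMulVec f (D.rightVec i) * Sᵀ = 0 := by
      rw [mul_vecMulVec, vecMulVec_mul, vecMul_transpose, hSv]
      ext a b
      simp [vecMulVec_apply]
    have e3 : R * (vecMulVec f (D.rightVec i))ᵀ = D.σ i • vecMulVec (D.leftVec i) f := by
      rw [transpose_vecMulVec, mul_vecMulVec, hR, smul_vecMulVec]
    have e4 : Wᵀ * (vecMulVec (D.leftVec i) f * S) = 0 := by
      rw [vecMulVec_mul, mul_vecMulVec, hWu, zero_vecMulVec]
    have e5 : Wᵀ * (W * vecMulVec f (D.rightVec i)) = w • vecMulVec f (D.rightVec i) := by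
      rw [mul_vecMulVec, mul_vecMulVec, hW, smul_vecMulVec]
    have e6 : (vecMulVec (D.leftVec i) f)ᵀ * R = D.σ i • vecMulVec f (D.rightVec i) := by
      rw [transpose_vecMulVec, vecMulVec_mul, ← mulVec_transpose, hRt]
      ext a b
      simp [vecMulVec_apply]
      ring
    congr 1
    · rw [Matrix.add_mul, Matrix.smul_mul, Matrix.smul_mul, Matrix.mul_smul, Matrix.smul_mul, e1,
        e2, Matrix.transpose_smul, Matrix.mul_smul, e3]
      module
    · rw [Matrix.mul_add, Matrix.smul_mul, Matrix.mul_smul, Matrix.mul_smul, Matrix.mul_smul, e4,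
        e5, Matrix.transpose_smul, Matrix.smul_mul, e6, smul_smul, smul_smul, smul_smul, smul_zero,
        zero_add, ← sub_smul]
      congr 1
      linear_combination hρ
  · intro h
    have h1 : D.σ i • vecMulVec (D.leftVec i) f = 0 := congrArg PairSpace.W h
    exact vecMulVec_ne_zero_of_ne_zero (D.leftVec_ne_zero i) hf ((smul_eq_zero.1 h1).resolve_left h0)

lemma canonicalPoint_W_mulVec_single (j : Fin q) :
    (xc).W *ᵥ Pi.single ((splitIndex hqk).symm (Sum.inl j)) 1 = D.leftVec (sel j) := by
  ext a
  simp [canonicalPoint_W, FullSVD.Ubar, FullSVD.leftVec]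

lemma hasEigenvalue_hessian_of_lam {i : Fin m} (hi : i ∉ Set.range sel) (h0 : D.σ i ≠ 0)
    (j : Fin q) {ρ : ℝ} (hρ : (D.lam sel j ^ 2 - ρ) * (1 - ρ) = D.σ i ^ 2) :
    (hessian (J X) (xc)).HasEigenvalue ρ := by
  refine hasEigenvalue_hessian_canonicalPoint D hqk sel C₀ hi h0
    (f := Pi.single ((splitIndex hqk).symm (Sum.inl j)) 1) ?_ ?_ ?_ hρ
  · simp
  · rw [canonicalPoint_S_mul_transpose_mulVec]
    ext l
    obtain ⟨s, rfl⟩ := (splitIndex hqk).symm.surjective l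
    have hz : (fun a => (Pi.single ((splitIndex hqk).symm (Sum.inl j)) 1 : Fin k → ℝ)
        ((splitIndex hqk).symm (Sum.inr a))) = 0 := by
      ext a
      simp
    simp only [hz, Function.comp, Equiv.apply_symm_apply]
    cases s with
    | inl i => by_cases h : i = j <;> simp [Pi.single_apply, h]
    | inr i => simp
  · rw [canonicalPoint_W_mulVec_single, canonicalPoint_W_transpose_mulVec_leftVec_sel, one_smul]

lemma hasEigenvalue_hessian_of_eigenvector {i : Fin m} (hi : i ∉ Set.range sel) (h0 : D.σ i ≠ 0)
    {c : Fin (k - q) → ℝ} (hc : c ≠ 0) {ω ρ : ℝ} (hω : (C₀ᵀ * C₀) *ᵥ c = ω • c)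
    (hρ : (ω - ρ) * (0 - ρ) = D.σ i ^ 2) :
    (hessian (J X) (xc)).HasEigenvalue ρ := by
  refine hasEigenvalue_hessian_canonicalPoint D hqk sel C₀ hi h0
    (f := Sum.elim 0 c ∘ splitIndex hqk) ?_ ?_ ?_ hρ
  · intro h
    refine hc (funext fun a => ?_)
    simpa using congrFun h ((splitIndex hqk).symm (Sum.inr a))
  · rw [canonicalPoint_S_mul_transpose_mulVec]
    ext l
    obtain ⟨s, rfl⟩ := (splitIndex hqk).symm.surjective l
    simp only [Function.comp, Equiv.apply_symm_apply, Sum.elim_inr, hω]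
    cases s <;> simp
  · have hW : (xc).W *ᵥ (Sum.elim 0 c ∘ splitIndex hqk) = 0 := by
      ext a
      simp only [Matrix.mulVec, dotProduct, canonicalPoint_W]
      rw [← (splitIndex hqk).symm.sum_comp, Fintype.sum_sum_type]
      simp
    rw [hW, mulVec_zero, zero_smul]

lemma hasEigenvalue_hessian_zero (hR : X - (xc).W * (xc).S = 0) (j : Fin q) :
    (hessian (J X) (xc)).HasEigenvalue 0 := by
  set e : Fin k → ℝ := Pi.single ((splitIndex hqk).symm (Sum.inl j)) 1 with he
  refine Module.End.hasEigenvalue_of_hasEigenvector (x := pair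
    ((xc).W * vecMulVec e e) (-(vecMulVec e e * (xc).S)))
    (Module.End.hasEigenvector_iff.2 ⟨Module.End.mem_eigenspace_iff.2 ?_, ?_⟩)
  · rw [hessian_J, hessianMap_apply]
    simp only [pair_W, pair_S, hR]
    rw [Matrix.mul_neg, Matrix.mul_assoc, add_neg_cancel]
    simp [pair_zero_zero]
  · intro h
    have h1 : (xc).W * vecMulVec e e = 0 := congrArg PairSpace.W h
    rw [mul_vecMulVec, canonicalPoint_W_mulVec_single] at h1
    exact vecMulVec_ne_zero_of_ne_zero (D.leftVec_ne_zero _) (by simp [he]) h1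

end Eigenvectors

section LeastEigenvalue

lemma exists_isMinEigenvalue_of_posSemidef {r : ℕ} (hr : 0 < r) {A : Matrix (Fin r) (Fin r) ℝ}
    (hA : A.PosSemidef) : ∃ ω, 0 ≤ ω ∧ IsMinEigenvalue (Matrix.toLin' A) ω ∧
      ∀ c, ω * (c ⬝ᵥ c) ≤ c ⬝ᵥ A *ᵥ c := by
  have hev : ∀ (B : Matrix (Fin r) (Fin r) ℝ) (hB : B.IsHermitian) (i : Fin r),
      ∃ c, c ≠ 0 ∧ B *ᵥ c = hB.eigenvalues i • c := fun B hB i =>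
    ⟨_, fun h => hB.eigenvectorBasis.toBasis.ne_zero i (by
      ext j
      simpa using congrFun h j), hB.mulVec_eigenvectorBasis i⟩
  have hiff : ∀ μ, Module.End.HasEigenvalue (Matrix.toLin' A) μ ↔ ∃ c, c ≠ 0 ∧ A *ᵥ c = μ • c := by
    intro μ
    constructor
    · intro h
      obtain ⟨c, hc⟩ := h.exists_hasEigenvector
      exact ⟨c, hc.2, by simpa using hc.apply_eq_smul⟩
    · rintro ⟨c, hc, hc'⟩
      exact Module.End.hasEigenvalue_of_hasEigenvector
        (Module.End.hasEigenvector_iff.2 ⟨Module.End.mem_eigenspace_iff.2 (by simpa using hc'), hc⟩)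
  have hne : {μ : ℝ | Module.End.HasEigenvalue (Matrix.toLin' A) μ}.Nonempty :=
    ⟨_, (hiff _).2 (hev A hA.isHermitian ⟨0, hr⟩)⟩
  obtain ⟨ω, hω⟩ := Set.Finite.exists_minimal (Module.End.finite_hasEigenvalue (Matrix.toLin' A)) hne
  have hmin : IsMinEigenvalue (Matrix.toLin' A) ω :=
    ⟨hω.1, fun μ hμ => (le_total ω μ).elim id fun h => hω.2 hμ h⟩
  have hB : (A - ω • (1 : Matrix (Fin r) (Fin r) ℝ)).IsHermitian := by
    refine hA.isHermitian.sub ?_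
    ext i j
    simp [Matrix.one_apply, eq_comm]
  have hB' : (A - ω • (1 : Matrix (Fin r) (Fin r) ℝ)).PosSemidef := by
    refine hB.posSemidef_iff_eigenvalues_nonneg.2 fun i => ?_
    obtain ⟨c, hc, hc'⟩ := hev _ hB i
    rw [sub_mulVec, smul_mulVec, one_mulVec, sub_eq_iff_eq_add, ← add_smul] at hc'
    have := hmin.2 ((hiff _).2 ⟨c, hc, hc'⟩)
    simpa using this
  refine ⟨ω, ?_, hmin, fun c => ?_⟩
  · obtain ⟨c, hc, hc'⟩ := (hiff ω).1 hω.1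
    have h := hA.dotProduct_mulVec_nonneg c
    rw [star_trivial, hc', dotProduct_smul, smul_eq_mul] at h
    have hpos : 0 < c ⬝ᵥ c :=
      (Finset.sum_nonneg fun i _ => mul_self_nonneg (c i)).lt_of_ne'
        fun h => hc (dotProduct_self_eq_zero.1 h)
    exact nonneg_of_mul_nonneg_left h hpos
  · have h := hB'.dotProduct_mulVec_nonneg c
    rw [star_trivial, sub_mulVec, smul_mulVec, one_mulVec, dotProduct_sub, dotProduct_smul,
      smul_eq_mul] at h
    linarith

lemma isMinEigenvalue_of_mul_inner_le {E : Type*} [NormedAddCommGroup E] [InnerProductSpace ℝ E]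
    {T : Module.End ℝ E} {ρ : ℝ} (h : T.HasEigenvalue ρ)
    (hT : ∀ y, ρ * inner ℝ y y ≤ inner ℝ (T y) y) : IsMinEigenvalue T ρ := by
  refine ⟨h, fun μ hμ => ?_⟩
  obtain ⟨y, hy⟩ := Module.End.HasEigenvalue.exists_hasEigenvector hμ
  have h1 := hT y
  rw [hy.apply_eq_smul, inner_smul_left] at h1
  exact le_of_mul_le_mul_right h1 (real_inner_self_pos.2 hy.2)

end LeastEigenvalue

section Selection

variable {m n q : ℕ} {X : Matrix (Fin m) (Fin n) ℝ} (D : FullSVD X) (hqm : q ≤ m)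
  (sel : Fin q ↪ Fin m)

lemma sigma_le_of_notMem_range {N : Fin m} (hN : (N : ℕ) ≤ q)
    (heq : ∀ j : Fin q, (j : ℕ) < N → D.lam sel j = D.σ (Fin.castLE hqm j)) {i : Fin m}
    (hi : i ∉ Set.range sel) : D.σ i ≤ D.σ N := by
  by_contra! hlt
  set A : Finset (Fin m) := Finset.univ.filter fun a => D.σ i ≤ D.σ a with hA
  set f : Fin m → Fin m := fun a => if h : (a : ℕ) < q then sel ⟨a, h⟩ else a with hf
  have hAN : ∀ a ∈ A, (a : ℕ) < N := fun a ha => by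
    by_contra! h
    exact absurd (D.sigma_antitone (Fin.le_def.2 h))
      (not_le.2 (hlt.trans_le (Finset.mem_filter.1 ha).2))
  have hfA : ∀ (a) (ha : a ∈ A), f a = sel ⟨a, (hAN a ha).trans_le hN⟩ := fun a ha => by
    simp [hf, (hAN a ha).trans_le hN]
  have hmaps : Set.MapsTo f A A := fun a ha => by
    have ha' : a ∈ A := ha
    rw [hfA a ha']
    refine Finset.mem_coe.2 (Finset.mem_filter.2 ⟨Finset.mem_univ _, ?_⟩)
    exact (Finset.mem_filter.1 ha').2.trans_eq (heq ⟨a, (hAN a ha').trans_le hN⟩ (hAN a ha')).symm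
  have hinj : Set.InjOn f A := fun a ha b hb hab => by
    rw [hfA a ha, hfA b hb] at hab
    have := sel.injective hab
    simpa [Fin.ext_iff] using this
  have hsurj := Finset.surjOn_of_injOn_of_card_le f hmaps hinj le_rfl
  obtain ⟨a, ha, hai⟩ := hsurj (Finset.mem_coe.2
    (Finset.mem_filter.2 ⟨Finset.mem_univ i, le_rfl⟩ : i ∈ A))
  rw [hfA a ha] at hai
  exact hi ⟨_, hai⟩

lemma exists_notMem_range_sigma_eq {N : Fin m} (hN : (N : ℕ) ≤ q)
    (heq : ∀ j : Fin q, (j : ℕ) < N → D.lam sel j = D.σ (Fin.castLE hqm j))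
    (hgap : ∀ j : Fin q, (N : ℕ) ≤ j → D.lam sel j < D.σ N) :
    ∃ i, i ∉ Set.range sel ∧ D.σ i = D.σ N := by
  by_contra! hno
  have hmem : ∀ i : Fin (N + 1), ∃ j : Fin N, ∃ h : (j : ℕ) < q,
      (sel ⟨j, h⟩ : ℕ) = i := by
    intro i
    have hiN : (i : ℕ) ≤ N := Nat.lt_succ_iff.1 i.isLt
    set i' : Fin m := ⟨i, hiN.trans_lt N.isLt⟩
    have hσ : D.σ N ≤ D.σ i' := D.sigma_antitone (Fin.le_def.2 hiN)
    have hr : i' ∈ Set.range sel := by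
      by_contra h
      exact hno i' h (le_antisymm (sigma_le_of_notMem_range D hqm sel hN heq h) hσ)
    obtain ⟨j, hj⟩ := hr
    have hjN : (j : ℕ) < N := by
      by_contra! h
      refine absurd (hgap j h) (not_lt.2 ?_)
      rwa [FullSVD.lam, hj]
    exact ⟨⟨j, hjN⟩, j.isLt, congrArg Fin.val hj⟩
  choose g hg hg' using hmem
  have hinj : Function.Injective g := fun a b hab => by
    refine Fin.ext ?_
    rw [← hg' a, ← hg' b]
    simp only [hab]
  have := Fintype.card_le_of_injective g hinj
  simp at this

lemma lam_le_sigma (hdecr : Antitone (D.lam sel)) (j : Fin q) :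
    D.lam sel j ≤ D.σ (Fin.castLE hqm j) := by
  by_contra! hlt
  have hmem : ∀ i : Fin (j + 1), (sel ⟨i, by omega⟩ : ℕ) < j := by
    intro i
    by_contra! h
    have h1 : D.lam sel j ≤ D.lam sel ⟨i, by omega⟩ :=
      hdecr (Fin.le_def.2 (Nat.lt_succ_iff.1 i.isLt))
    have h2 : D.lam sel ⟨i, by omega⟩ ≤ D.σ (Fin.castLE hqm j) := D.sigma_antitone h
    linarith
  have hinj : Function.Injective fun i : Fin (j + 1) => (⟨_, hmem i⟩ : Fin j) := fun a b hab => by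
    have h : sel ⟨a, by omega⟩ = sel ⟨b, by omega⟩ := Fin.ext (Fin.ext_iff.1 hab :)
    have h' := sel.injective h
    simpa [Fin.ext_iff] using h'
  have := Fintype.card_le_of_injective _ hinj
  simp at this

lemma exists_isFirstGap (hdecr : Antitone (D.lam sel)) (h : ¬ IsMaximal D hqm sel) :
    ∃ p, IsFirstGap D hqm sel p := by
  have hne : {j : Fin q | D.lam sel j < D.σ (Fin.castLE hqm j)}.Nonempty := by
    by_contra hempty
    refine h fun j => le_antisymm (lam_le_sigma D hqm sel hdecr j) (not_lt.1 fun hj => ?_)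
    exact hempty ⟨j, hj⟩
  obtain ⟨p, hp⟩ := Set.Finite.exists_minimal (Set.toFinite _) hne
  exact ⟨p, hp.1, fun j hj => (le_total p j).elim id fun h => hp.2 hj h⟩

lemma IsFirstGap.lam_eq_of_lt {p : Fin q} (hp : IsFirstGap D hqm sel p)
    (hdecr : Antitone (D.lam sel)) {j : Fin q} (hj : (j : ℕ) < p) :
    D.lam sel j = D.σ (Fin.castLE hqm j) :=
  le_antisymm (lam_le_sigma D hqm sel hdecr j) (not_lt.1 fun h =>
    absurd (hp.2 h) (not_le.2 (Fin.lt_def.2 hj)))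

end Selection

section GlobalMinimum

variable {m n k q : ℕ} {X : Matrix (Fin m) (Fin n) ℝ} (D : FullSVD X) (hqk : q ≤ k)
  (sel : Fin q ↪ Fin m) (C₀ : Matrix (Fin (n - X.rank)) (Fin (k - q)) ℝ)

local notation "xc" => canonicalPoint D hqk sel C₀

lemma exists_orthonormal_ker_transpose (W : Matrix (Fin m) (Fin k) ℝ) :
    ∃ w : Fin (m - k) → Fin m → ℝ, (∀ s t, w s ⬝ᵥ w t = if s = t then 1 else 0) ∧
      ∀ t, Wᵀ *ᵥ w t = 0 := by
  set f : EuclideanSpace ℝ (Fin m) →ₗ[ℝ] (Fin k → ℝ) :=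
    Wᵀ.mulVecLin ∘ₗ (WithLp.linearEquiv 2 ℝ (Fin m → ℝ)).toLinearMap with hf
  have h1 := f.finrank_range_add_finrank_ker
  have h2 := Submodule.finrank_le (LinearMap.range f)
  rw [finrank_euclideanSpace_fin] at h1
  rw [Module.finrank_fin_fun] at h2
  have hle : m - k ≤ Module.finrank ℝ (LinearMap.ker f) := by omega
  set b := stdOrthonormalBasis ℝ (LinearMap.ker f) with hb
  refine ⟨fun t => WithLp.ofLp (b (Fin.castLE hle t) : EuclideanSpace ℝ (Fin m)),
    fun s t => ?_, fun t => (b (Fin.castLE hle t)).2⟩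
  have h := orthonormal_iff_ite.1 b.orthonormal (Fin.castLE hle s) (Fin.castLE hle t)
  rw [Submodule.coe_inner, EuclideanSpace.inner_eq_star_dotProduct, star_trivial,
    dotProduct_comm] at h
  simpa [Fin.ext_iff] using h

lemma FullSVD.sum_sq_leftVec_dotProduct (y : Fin m → ℝ) :
    ∑ i, (D.leftVec i ⬝ᵥ y) ^ 2 = y ⬝ᵥ y := by
  have h : ∑ i, (D.leftVec i ⬝ᵥ y) ^ 2 = (D.Uᵀ *ᵥ y) ⬝ᵥ (D.Uᵀ *ᵥ y) :=
    Finset.sum_congr rfl fun i _ => sq _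
  have hU : D.U * D.Uᵀ = 1 := (mem_orthogonalGroup_iff _ _).1 D.U_mem
  rw [h, dotProduct_mulVec, vecMul_transpose, mulVec_mulVec, hU, one_mulVec]

lemma FullSVD.transpose_mulVec_dotProduct_self (y : Fin m → ℝ) :
    (Xᵀ *ᵥ y) ⬝ᵥ (Xᵀ *ᵥ y) = ∑ i, D.σ i ^ 2 * (D.leftVec i ⬝ᵥ y) ^ 2 := by
  have h : Xᵀ *ᵥ y = ∑ i, (D.σ i * (D.leftVec i ⬝ᵥ y)) • D.rightVec i := by
    conv_lhs => rw [D.eq_sum_vecMulVec]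
    rw [transpose_sum, sum_mulVec]
    refine Finset.sum_congr rfl fun i _ => ?_
    rw [transpose_smul, transpose_vecMulVec, smul_mulVec, vecMulVec_mulVec]
    ext b
    simp
    ring
  rw [h, sum_dotProduct]
  refine Finset.sum_congr rfl fun i _ => ?_
  by_cases h0 : D.σ i = 0
  · simp [h0]
  · rw [dotProduct_sum, Finset.sum_eq_single i]
    · rw [smul_dotProduct, dotProduct_smul, D.rightVec_dotProduct h0]
      simp
      ring
    · intro j _ hji
      rw [smul_dotProduct, dotProduct_smul, dotProduct_comm (D.rightVec i),
        D.rightVec_dotProduct h0]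
      simp [hji]
    · simp

lemma sum_sq_residual_canonicalPoint :
    ∑ a, ∑ b, (X - (xc).W * (xc).S) a b ^ 2 = ∑ i ∈ (Finset.univ.map sel)ᶜ, D.σ i ^ 2 := by
  have h := sum_sum_vecMulVec_mul (Finset.univ.map sel)ᶜ D.σ D.leftVec D.rightVec
    (X - (xc).W * (xc).S)
  rw [← residual_canonicalPoint D hqk sel C₀] at h
  simp only [sq]
  rw [h]
  refine Finset.sum_congr rfl fun i hi => ?_
  by_cases h0 : D.σ i = 0
  · simp [h0]
  · rw [residual_mulVec_rightVec D hqk sel C₀ (by simpa using hi) h0, dotProduct_smul,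
      D.leftVec_dotProduct]
    simp

theorem isGlobalMin_canonicalPoint_of_threshold (hk : q = k) {τ : ℝ} (hτ : 0 ≤ τ)
    (hunsel : ∀ i, i ∉ Set.range sel → D.σ i ≤ τ) (hsel : ∀ j, τ ≤ D.lam sel j) :
    IsGlobalMin (J X) (xc) := by
  intro y
  unfold J
  rw [sum_sq_residual_canonicalPoint]
  refine mul_le_mul_of_nonneg_left ?_ (by norm_num)
  obtain ⟨w, hw, hWw⟩ := exists_orthonormal_ker_transpose y.W
  refine le_trans ?_ (sum_dotProduct_transpose_mulVec_le Finset.univ w (fun s _ t _ => hw s t) _)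
  have hres : ∀ t, (X - y.W * y.S)ᵀ *ᵥ w t = Xᵀ *ᵥ w t := fun t => by
    rw [transpose_sub, transpose_mul, sub_mulVec, ← mulVec_mulVec, hWw, mulVec_zero, sub_zero]
  simp only [hres, D.transpose_mulVec_dotProduct_self]
  rw [Finset.sum_comm]
  simp only [← Finset.mul_sum]
  set c : Fin m → ℝ := fun i => ∑ t, (D.leftVec i ⬝ᵥ w t) ^ 2 with hc
  have hc0 : ∀ i, 0 ≤ c i := fun i => Finset.sum_nonneg fun t _ => sq_nonneg _
  have hc1 : ∀ i, c i ≤ 1 := fun i => by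
    have h := sum_sq_dotProduct_le Finset.univ w (fun s _ t _ => hw s t) (D.leftVec i)
    rw [D.leftVec_dotProduct, if_pos rfl] at h
    simpa only [hc, dotProduct_comm] using h
  have hcsum : ∑ i, c i = ((m - k : ℕ) : ℝ) := by
    rw [hc, Finset.sum_comm]
    simp [D.sum_sq_leftVec_dotProduct, hw]
  have hcard : ((Finset.univ.map sel)ᶜ.card : ℝ) = ((m - k : ℕ) : ℝ) := by
    rw [Finset.card_compl, Finset.card_map, Finset.card_univ, Fintype.card_fin, Fintype.card_fin,
      hk]
  rw [← Finset.sum_compl_add_sum (Finset.univ.map sel)] at hcsum ⊢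
  have h1 : ∑ i ∈ (Finset.univ.map sel)ᶜ, D.σ i ^ 2 * (1 - c i)
      ≤ ∑ i ∈ (Finset.univ.map sel)ᶜ, τ ^ 2 * (1 - c i) :=
    Finset.sum_le_sum fun i hi => mul_le_mul_of_nonneg_right
      (pow_le_pow_left₀ (D.sigma_nonneg i) (hunsel i (by simpa using hi)) 2)
      (sub_nonneg.2 (hc1 i))
  have h2 : ∑ i ∈ Finset.univ.map sel, τ ^ 2 * c i
      ≤ ∑ i ∈ Finset.univ.map sel, D.σ i ^ 2 * c i := by
    refine Finset.sum_le_sum fun i hi => mul_le_mul_of_nonneg_right ?_ (hc0 i)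
    obtain ⟨j, -, rfl⟩ := Finset.mem_map.1 hi
    exact pow_le_pow_left₀ hτ (hsel j) 2
  simp only [← Finset.mul_sum, mul_sub, mul_one, Finset.sum_sub_distrib, Finset.sum_const,
    nsmul_eq_mul, hcard] at h1 h2
  rw [← hcsum] at h1
  linarith

lemma residual_canonicalPoint_eq_zero (h : ∀ i, i ∉ Set.range sel → D.σ i = 0) :
    X - (xc).W * (xc).S = 0 := by
  rw [residual_canonicalPoint]
  refine Finset.sum_eq_zero fun i hi => ?_
  rw [h i (by simpa using hi), zero_smul]

lemma isGlobalMin_of_residual_eq_zero {x : PairSpace m k n} (h : X - x.W * x.S = 0) :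
    IsGlobalMin (J X) x := by
  intro y
  have h0 : J X x = 0 := by
    rw [J, h]
    simp
  rw [h0]
  unfold J
  positivity

end GlobalMinimum

section Scalars

lemma quadratic_dotProduct_nonneg {r : ℕ} {A : Matrix (Fin r) (Fin r) ℝ} {ω ρ μ s : ℝ}
    (hA : ∀ c, ω * (c ⬝ᵥ c) ≤ c ⬝ᵥ A *ᵥ c) (hω : 0 ≤ ω) (hρ : ρ ≤ 0)
    (hμ : μ ^ 2 ≤ (ω - ρ) * (0 - ρ)) (hs0 : 0 ≤ s) (hs : s ≤ μ) (c d : Fin r → ℝ) :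
    0 ≤ c ⬝ᵥ A *ᵥ c - 2 * s * (c ⬝ᵥ d) - ρ * (c ⬝ᵥ c + d ⬝ᵥ d) := by
  have h : 0 ≤ ∑ i, ((ω - ρ) * c i ^ 2 + (0 - ρ) * d i ^ 2 - 2 * s * (c i * d i)) :=
    Finset.sum_nonneg fun i _ => quadratic_nonneg (by linarith) (by linarith)
      ((pow_le_pow_left₀ hs0 hs 2).trans hμ) _ _
  simp only [Finset.sum_sub_distrib, Finset.sum_add_distrib, ← Finset.mul_sum, sq] at h
  have := hA c
  simp only [dotProduct] at this ⊢
  linarith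

lemma sub_mul_sub_le_of_le {a b ρ ρ₀ : ℝ} (h : ρ ≤ ρ₀) (ha : ρ₀ ≤ a) (hb : ρ₀ ≤ b) :
    (a - ρ₀) * (b - ρ₀) ≤ (a - ρ) * (b - ρ) :=
  mul_le_mul (by linarith) (by linarith) (by linarith) (by linarith)

lemma first_root_mul (ω μ : ℝ) :
    (ω - (ω / 2 - √(μ ^ 2 + (ω / 2) ^ 2))) * (0 - (ω / 2 - √(μ ^ 2 + (ω / 2) ^ 2))) = μ ^ 2 := by
  linear_combination Real.sq_sqrt (show 0 ≤ μ ^ 2 + (ω / 2) ^ 2 by positivity)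

lemma first_root_neg {ω μ : ℝ} (hμ : 0 < μ) : ω / 2 - √(μ ^ 2 + (ω / 2) ^ 2) < 0 :=
  sub_neg.2 (Real.lt_sqrt_of_sq_lt (by nlinarith))

lemma second_root_mul (l μ : ℝ) :
    (l ^ 2 - 1 / 2 * (l ^ 2 + 1 - √((l ^ 2 - 1) ^ 2 + 4 * μ ^ 2)))
      * (1 - 1 / 2 * (l ^ 2 + 1 - √((l ^ 2 - 1) ^ 2 + 4 * μ ^ 2))) = μ ^ 2 := by
  linear_combination (1 / 4) * Real.sq_sqrt (show 0 ≤ (l ^ 2 - 1) ^ 2 + 4 * μ ^ 2 by positivity)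

lemma second_root_neg {l μ : ℝ} (hl : 0 ≤ l) (hμ : l < μ) :
    1 / 2 * (l ^ 2 + 1 - √((l ^ 2 - 1) ^ 2 + 4 * μ ^ 2)) < 0 := by
  have : l ^ 2 + 1 < √((l ^ 2 - 1) ^ 2 + 4 * μ ^ 2) :=
    Real.lt_sqrt_of_sq_lt (by nlinarith)
  linarith

lemma neg_div_eq_second_root {l μ : ℝ} :
    -((μ ^ 2 - l ^ 2) / ((l ^ 2 + 1) / 2 + √(μ ^ 2 + ((l ^ 2 - 1) / 2) ^ 2)))
      = 1 / 2 * (l ^ 2 + 1 - √((l ^ 2 - 1) ^ 2 + 4 * μ ^ 2)) := by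
  have h2 : √((l ^ 2 - 1) ^ 2 + 4 * μ ^ 2) = 2 * √(μ ^ 2 + ((l ^ 2 - 1) / 2) ^ 2) := by
    rw [show (l ^ 2 - 1) ^ 2 + 4 * μ ^ 2 = 2 ^ 2 * (μ ^ 2 + ((l ^ 2 - 1) / 2) ^ 2) by ring,
      Real.sqrt_mul (by positivity), Real.sqrt_sq (by norm_num)]
  have h3 := Real.sq_sqrt (show 0 ≤ μ ^ 2 + ((l ^ 2 - 1) / 2) ^ 2 by positivity)
  have hpos : 0 < (l ^ 2 + 1) / 2 + √(μ ^ 2 + ((l ^ 2 - 1) / 2) ^ 2) := by positivity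
  rw [h2, ← neg_div, div_eq_iff hpos.ne']
  linear_combination h3

end Scalars

section Selection

variable {m n k q : ℕ} {X : Matrix (Fin m) (Fin n) ℝ} (D : FullSVD X) (hqm : q ≤ m)
  (sel : Fin q ↪ Fin m)

lemma IsMaximal.sigma_le {hqm : q ≤ m} (h : IsMaximal D hqm sel) (hqm' : q < m) {i : Fin m}
    (hi : i ∉ Set.range sel) : D.σ i ≤ D.σ ⟨q, hqm'⟩ :=
  sigma_le_of_notMem_range D hqm sel (N := ⟨q, hqm'⟩) le_rfl (fun j _ => h j) hi

lemma IsMaximal.exists_sigma_eq {hqm : q ≤ m} (h : IsMaximal D hqm sel) (hqm' : q < m) :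
    ∃ i, i ∉ Set.range sel ∧ D.σ i = D.σ ⟨q, hqm'⟩ :=
  exists_notMem_range_sigma_eq D hqm sel (N := ⟨q, hqm'⟩) le_rfl (fun j _ => h j)
    fun j hj => absurd j.isLt (not_lt.2 hj)

lemma IsMaximal.le_lam {hqm : q ≤ m} (h : IsMaximal D hqm sel) (hqm' : q < m) (j : Fin q) :
    D.σ ⟨q, hqm'⟩ ≤ D.lam sel j := by
  rw [h j]
  exact D.sigma_antitone (Fin.le_def.2 j.isLt.le)

lemma IsFirstGap.sigma_le {hqm : q ≤ m} {p : Fin q} (h : IsFirstGap D hqm sel p)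
    (hdecr : Antitone (D.lam sel)) {i : Fin m} (hi : i ∉ Set.range sel) :
    D.σ i ≤ D.σ (Fin.castLE hqm p) :=
  sigma_le_of_notMem_range D hqm sel p.isLt.le (fun _ hj => h.lam_eq_of_lt D hqm sel hdecr hj) hi

lemma IsFirstGap.exists_sigma_eq {hqm : q ≤ m} {p : Fin q} (h : IsFirstGap D hqm sel p)
    (hdecr : Antitone (D.lam sel)) :
    ∃ i, i ∉ Set.range sel ∧ D.σ i = D.σ (Fin.castLE hqm p) :=
  exists_notMem_range_sigma_eq D hqm sel p.isLt.le
    (fun _ hj => h.lam_eq_of_lt D hqm sel hdecr hj)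
    fun _ hj => (hdecr (Fin.le_def.2 hj)).trans_lt h.1

end Selection

section LeastEigenvalue

variable {m n k q : ℕ} {X : Matrix (Fin m) (Fin n) ℝ} (D : FullSVD X) (hqk : q ≤ k)
  (sel : Fin q ↪ Fin m) (C₀ : Matrix (Fin (n - X.rank)) (Fin (k - q)) ℝ)

local notation "xc" => canonicalPoint D hqk sel C₀

lemma isStrictSaddle_canonicalPoint {ρ : ℝ} (hρ : ρ < 0)
    (h : IsMinEigenvalue (hessian (J X) (xc)) ρ) : IsStrictSaddle (J X) (xc) :=
  ⟨gradient_canonicalPoint D hqk sel C₀, ρ, hρ, h.1⟩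

theorem isMinEigenvalue_hessian_of_eq {μ l : ℝ} {i : Fin m} (hi : i ∉ Set.range sel)
    (hiμ : D.σ i = μ) (hle : ∀ i, i ∉ Set.range sel → D.σ i ≤ μ) (hk : q = k) {j : Fin q}
    (hj : l = D.lam sel j) (hl : ∀ j, l ≤ D.lam sel j) (hlμ : l < μ) :
    IsMinEigenvalue (hessian (J X) (xc))
      (1 / 2 * (l ^ 2 + 1 - √((l ^ 2 - 1) ^ 2 + 4 * μ ^ 2))) := by
  have hl0 : 0 ≤ l := hj ▸ D.sigma_nonneg _
  have hneg := second_root_neg hl0 hlμ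
  have hmul := second_root_mul l μ
  set ρ := 1 / 2 * (l ^ 2 + 1 - √((l ^ 2 - 1) ^ 2 + 4 * μ ^ 2)) with hρ
  refine isMinEigenvalue_of_mul_inner_le
    (hasEigenvalue_hessian_of_lam D hqk sel C₀ hi (by linarith) j (by rw [← hj, hmul, hiμ])) ?_
  refine mul_inner_self_le_inner_hessian_canonicalPoint D hqk sel C₀ hneg.le hle (fun j => ?_)
    fun c d s _ _ => ?_
  · rw [← hmul]
    exact mul_le_mul_of_nonneg_right (by linarith [pow_le_pow_left₀ hl0 (hl j) 2]) (by linarith)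
  · have : IsEmpty (Fin (k - q)) := by
      rw [hk, Nat.sub_self]
      infer_instance
    simp [dotProduct]

theorem isMinEigenvalue_hessian_of_lt {μ l ω : ℝ} {i : Fin m} (hi : i ∉ Set.range sel)
    (hiμ : D.σ i = μ) (hle : ∀ i, i ∉ Set.range sel → D.σ i ≤ μ) {j : Fin q}
    (hj : l = D.lam sel j) (hl : ∀ j, l ≤ D.lam sel j) (hlμ : l < μ) (hω0 : 0 ≤ ω)
    (hω : IsMinEigenvalue (Matrix.toLin' (C₀ᵀ * C₀)) ω)
    (hC : ∀ c, ω * (c ⬝ᵥ c) ≤ c ⬝ᵥ (C₀ᵀ * C₀) *ᵥ c) :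
    IsMinEigenvalue (hessian (J X) (xc)) (min (ω / 2 - √(μ ^ 2 + (ω / 2) ^ 2))
      (1 / 2 * (l ^ 2 + 1 - √((l ^ 2 - 1) ^ 2 + 4 * μ ^ 2)))) := by
  have hl0 : 0 ≤ l := hj ▸ D.sigma_nonneg _
  have hi0 : D.σ i ≠ 0 := by linarith
  have hneg1 := first_root_neg (ω := ω) (hl0.trans_lt hlμ)
  have hmul1 := first_root_mul ω μ
  have hneg2 := second_root_neg hl0 hlμ
  have hmul2 := second_root_mul l μ
  set ρ₁ := ω / 2 - √(μ ^ 2 + (ω / 2) ^ 2)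
  set ρ₂ := 1 / 2 * (l ^ 2 + 1 - √((l ^ 2 - 1) ^ 2 + 4 * μ ^ 2))
  have h1 := min_le_left ρ₁ ρ₂
  have h2 := min_le_right ρ₁ ρ₂
  refine isMinEigenvalue_of_mul_inner_le ?_ ?_
  · rcases min_choice ρ₁ ρ₂ with h | h <;> rw [h]
    · obtain ⟨c, hc⟩ := Module.End.HasEigenvalue.exists_hasEigenvector hω.1
      exact hasEigenvalue_hessian_of_eigenvector D hqk sel C₀ hi hi0 hc.2
        (by simpa using hc.apply_eq_smul) (by rw [hmul1, hiμ])
    · exact hasEigenvalue_hessian_of_lam D hqk sel C₀ hi hi0 j (by rw [← hj, hmul2, hiμ])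
  · refine mul_inner_self_le_inner_hessian_canonicalPoint D hqk sel C₀ (h1.trans hneg1.le) hle
      (fun j => ?_) fun c d s hs0 hs => ?_
    · have hlj := pow_le_pow_left₀ hl0 (hl j) 2
      rw [← hmul2]
      refine (sub_mul_sub_le_of_le h2 (by nlinarith) (by linarith)).trans ?_
      exact mul_le_mul_of_nonneg_right (by linarith) (by linarith)
    · refine quadratic_dotProduct_nonneg hC hω0 (h1.trans hneg1.le) ?_ hs0 hs c d
      rw [← hmul1]
      exact sub_mul_sub_le_of_le h1 (by linarith) hneg1.le

theorem isMinEigenvalue_hessian_of_le {μ ω : ℝ} {i : Fin m} (hi : i ∉ Set.range sel)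
    (hiμ : D.σ i = μ) (hle : ∀ i, i ∉ Set.range sel → D.σ i ≤ μ) (hq : 0 < q)
    (hl : ∀ j, μ ≤ D.lam sel j) (hω0 : 0 ≤ ω)
    (hω : IsMinEigenvalue (Matrix.toLin' (C₀ᵀ * C₀)) ω)
    (hC : ∀ c, ω * (c ⬝ᵥ c) ≤ c ⬝ᵥ (C₀ᵀ * C₀) *ᵥ c) :
    IsMinEigenvalue (hessian (J X) (xc)) (ω / 2 - √(μ ^ 2 + (ω / 2) ^ 2)) := by
  have hμ0 : 0 ≤ μ := hiμ ▸ D.sigma_nonneg _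
  have hmul := first_root_mul ω μ
  have hneg : ω / 2 - √(μ ^ 2 + (ω / 2) ^ 2) ≤ 0 :=
    sub_nonpos.2 (Real.le_sqrt_of_sq_le (by nlinarith))
  have hzero : μ = 0 → ω / 2 - √(μ ^ 2 + (ω / 2) ^ 2) = 0 := by
    rintro rfl
    rw [zero_pow two_ne_zero, zero_add, Real.sqrt_sq (by linarith), sub_self]
  set ρ := ω / 2 - √(μ ^ 2 + (ω / 2) ^ 2)
  refine isMinEigenvalue_of_mul_inner_le ?_ ?_
  · by_cases h0 : μ = 0
    · rw [hzero h0]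
      exact hasEigenvalue_hessian_zero D hqk sel C₀ (residual_canonicalPoint_eq_zero D hqk sel C₀
        fun i hi => le_antisymm ((hle i hi).trans_eq h0) (D.sigma_nonneg i)) ⟨0, hq⟩
    · obtain ⟨c, hc⟩ := Module.End.HasEigenvalue.exists_hasEigenvector hω.1
      exact hasEigenvalue_hessian_of_eigenvector D hqk sel C₀ hi (hiμ ▸ h0) hc.2
        (by simpa using hc.apply_eq_smul) (by rw [hmul, hiμ])
  · refine mul_inner_self_le_inner_hessian_canonicalPoint D hqk sel C₀ hneg hle
      (fun j => ?_) fun c d s hs0 hs => quadratic_dotProduct_nonneg hC hω0 hneg hmul.ge hs0 hs c d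
    have hlj := pow_le_pow_left₀ hμ0 (hl j) 2
    nlinarith [mul_nonneg (sub_nonneg.2 hlj) (neg_nonneg.2 hneg), sq_nonneg (D.lam sel j),
      mul_nonneg (sq_nonneg (D.lam sel j)) (neg_nonneg.2 hneg)]

end LeastEigenvalue

end MatFact

theorem mainTheorem4 {m n k q : ℕ} (X : Matrix (Fin m) (Fin n) ℝ) (D : MatFact.FullSVD X)
    (hq : 1 ≤ q) (hqk : q ≤ k) (hqm : q ≤ m)
    (sel : Fin q ↪ Fin m) (hdecr : Antitone (D.lam sel))
    (C₀ : Matrix (Fin (n - X.rank)) (Fin (k - q)) ℝ) :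
    -- part (a)
    ((q = m ∨ (q = k ∧ k < m ∧ MatFact.IsMaximal D hqm sel)) →
      MatFact.IsGlobalMin (MatFact.J X) (MatFact.canonicalPoint D hqk sel C₀)) ∧
    -- part (b); the last selected singular value is `λ_k`, since `q = k`
    (q = k → k < m → ¬ MatFact.IsMaximal D hqm sel →
      MatFact.IsStrictSaddle (MatFact.J X) (MatFact.canonicalPoint D hqk sel C₀) ∧
      ∃ p : Fin q, MatFact.IsFirstGap D hqm sel p ∧
        ∀ σp lamk : ℝ, σp = D.σ (Fin.castLE hqm p) →
          lamk = D.lam sel ⟨q - 1, by omega⟩ →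
          MatFact.IsMinEigenvalue
            (MatFact.hessian (MatFact.J X) (MatFact.canonicalPoint D hqk sel C₀))
            (-((σp ^ 2 - lamk ^ 2) /
              ((lamk ^ 2 + 1) / 2 + Real.sqrt (σp ^ 2 + ((lamk ^ 2 - 1) / 2) ^ 2))))) ∧
    -- part (c); `ω` is the smallest eigenvalue `ω_{k-q}` of `C₀ᵀ C₀`
    (∀ (hqm' : q < m), q < k →
      (¬ (MatFact.IsMaximal D hqm sel ∧ D.σ ⟨q, hqm'⟩ = 0) →
        MatFact.IsStrictSaddle (MatFact.J X) (MatFact.canonicalPoint D hqk sel C₀)) ∧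
      (MatFact.IsMaximal D hqm sel → D.σ ⟨q, hqm'⟩ = 0 →
        MatFact.IsGlobalMin (MatFact.J X) (MatFact.canonicalPoint D hqk sel C₀)) ∧
      ∃ ω : ℝ, MatFact.IsMinEigenvalue (Matrix.toLin' (C₀.transpose * C₀)) ω ∧
        (MatFact.IsMaximal D hqm sel →
          MatFact.IsMinEigenvalue
            (MatFact.hessian (MatFact.J X) (MatFact.canonicalPoint D hqk sel C₀))
            (ω / 2 - Real.sqrt ((D.σ ⟨q, hqm'⟩) ^ 2 + (ω / 2) ^ 2))) ∧
        (¬ MatFact.IsMaximal D hqm sel →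
          ∃ p : Fin q, MatFact.IsFirstGap D hqm sel p ∧
            ∀ σp lamq : ℝ, σp = D.σ (Fin.castLE hqm p) →
              lamq = D.lam sel ⟨q - 1, by omega⟩ →
              MatFact.IsMinEigenvalue
                (MatFact.hessian (MatFact.J X) (MatFact.canonicalPoint D hqk sel C₀))
                (min (ω / 2 - Real.sqrt (σp ^ 2 + (ω / 2) ^ 2))
                  ((1 / 2) * (lamq ^ 2 + 1 -
                    Real.sqrt ((lamq ^ 2 - 1) ^ 2 + 4 * σp ^ 2)))))) := by
  have hlast : ∀ j : Fin q, D.lam sel ⟨q - 1, by omega⟩ ≤ D.lam sel j := fun j =>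
    hdecr (Fin.le_def.2 (Nat.le_sub_one_of_lt j.isLt))
  refine ⟨?_, ?_, ?_⟩
  · rintro (hm | ⟨hk, hkm, hmax⟩)
    · refine MatFact.isGlobalMin_of_residual_eq_zero
        (MatFact.residual_canonicalPoint_eq_zero D hqk sel C₀ fun i hi => absurd ?_ hi)
      subst hm
      exact Finite.surjective_of_injective sel.injective i
    · have hqm' : q < m := hk ▸ hkm
      exact MatFact.isGlobalMin_canonicalPoint_of_threshold D hqk sel C₀ hk
        (D.sigma_nonneg ⟨q, hqm'⟩) (fun i hi => hmax.sigma_le D sel hqm' hi)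
        (hmax.le_lam D sel hqm')
  · intro hk _ hmax
    obtain ⟨p, hp⟩ := MatFact.exists_isFirstGap D hqm sel hdecr hmax
    obtain ⟨i, hi, hiσ⟩ := hp.exists_sigma_eq D sel hdecr
    have hlt : D.lam sel ⟨q - 1, by omega⟩ < D.σ (Fin.castLE hqm p) := (hlast p).trans_lt hp.1
    have hmin := MatFact.isMinEigenvalue_hessian_of_eq D hqk sel C₀ hi hiσ
      (fun i hi => hp.sigma_le D sel hdecr hi) hk rfl hlast hlt
    refine ⟨MatFact.isStrictSaddle_canonicalPoint D hqk sel C₀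
      (MatFact.second_root_neg (D.sigma_nonneg _) hlt) hmin, p, hp, ?_⟩
    rintro σp lamk rfl rfl
    rwa [MatFact.neg_div_eq_second_root]
  · intro hqm' hqk'
    have hpsd : (C₀.transpose * C₀).PosSemidef := Matrix.posSemidef_conjTranspose_mul_self C₀
    obtain ⟨ω, hω0, hω, hC⟩ :=
      MatFact.exists_isMinEigenvalue_of_posSemidef (Nat.sub_pos_of_lt hqk') hpsd
    have hmaxmin : MatFact.IsMaximal D hqm sel → MatFact.IsMinEigenvalue
        (MatFact.hessian (MatFact.J X) (MatFact.canonicalPoint D hqk sel C₀))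
        (ω / 2 - Real.sqrt ((D.σ ⟨q, hqm'⟩) ^ 2 + (ω / 2) ^ 2)) := by
      intro hmax
      obtain ⟨i, hi, hiσ⟩ := hmax.exists_sigma_eq D sel hqm'
      exact MatFact.isMinEigenvalue_hessian_of_le D hqk sel C₀ hi hiσ
        (fun i hi => hmax.sigma_le D sel hqm' hi) hq (hmax.le_lam D sel hqm') hω0 hω hC
    have hgap : ∀ p, MatFact.IsFirstGap D hqm sel p →
        D.lam sel ⟨q - 1, by omega⟩ < D.σ (Fin.castLE hqm p) :=
      fun p hp => (hlast p).trans_lt hp.1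
    have hgapmin : ∀ p, MatFact.IsFirstGap D hqm sel p → MatFact.IsMinEigenvalue
        (MatFact.hessian (MatFact.J X) (MatFact.canonicalPoint D hqk sel C₀))
        (min (ω / 2 - Real.sqrt (D.σ (Fin.castLE hqm p) ^ 2 + (ω / 2) ^ 2))
          ((1 / 2) * (D.lam sel ⟨q - 1, by omega⟩ ^ 2 + 1 -
            Real.sqrt ((D.lam sel ⟨q - 1, by omega⟩ ^ 2 - 1) ^ 2
              + 4 * D.σ (Fin.castLE hqm p) ^ 2)))) := fun p hp => by
      obtain ⟨i, hi, hiσ⟩ := hp.exists_sigma_eq D sel hdecr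
      exact MatFact.isMinEigenvalue_hessian_of_lt D hqk sel C₀ hi hiσ
        (fun i hi => hp.sigma_le D sel hdecr hi) rfl hlast (hgap p hp) hω0 hω hC
    refine ⟨fun hnd => ?_, fun hmax h0 => ?_, ω, hω, hmaxmin, fun hmax => ?_⟩
    · by_cases hmax : MatFact.IsMaximal D hqm sel
      · have hpos : 0 < D.σ ⟨q, hqm'⟩ :=
          (D.sigma_nonneg _).lt_of_ne' fun h0 => hnd ⟨hmax, h0⟩
        exact MatFact.isStrictSaddle_canonicalPoint D hqk sel C₀
          (MatFact.first_root_neg hpos) (hmaxmin hmax)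
      · obtain ⟨p, hp⟩ := MatFact.exists_isFirstGap D hqm sel hdecr hmax
        exact MatFact.isStrictSaddle_canonicalPoint D hqk sel C₀ ((min_le_right _ _).trans_lt
          (MatFact.second_root_neg (D.sigma_nonneg _) (hgap p hp))) (hgapmin p hp)
    · exact MatFact.isGlobalMin_of_residual_eq_zero
        (MatFact.residual_canonicalPoint_eq_zero D hqk sel C₀ fun i hi =>
          le_antisymm ((hmax.sigma_le D sel hqm' hi).trans_eq h0) (D.sigma_nonneg i))
    · obtain ⟨p, hp⟩ := MatFact.exists_isFirstGap D hqm sel hdecr hmax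
      refine ⟨p, hp, ?_⟩
      rintro σp lamq rfl rfl
      exact hgapmin p hp
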